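/- **Proposition (Dual problem for factor matrices).** Let $X\in\mathbb R_{\ge0}^{n_1\times\cdots\times n_d}$, $S\in\mathbb R_{\ge0}^{r_1\times\cdots\times r_d}$, fix a mode $k$ and matrices $A^{(j)}\in\mathbb R_{\ge0}^{n_j\times r_j}$ for $j\ne k$, and let $\rho_k>0$. Write $S[A^{(1)},\dots,A^{(d)}]_{i_1\dots i_d}=\sum_{l_1,\dots,l_d}S_{l_1\dots l_d}\prod_j A^{(j)}_{i_jl_j}$, $\langle\cdot,\cdot\rangle$ for the entrywise inner product, $\mathbf 1$ for an all-ones vector or matrix, $T\times_j M$ for the mode-$j$ product and $T_{(k)}$ for the mode-$k$ matricisation. Let $\Sigma_k\subseteq\mathbb R^{n_k\times r_k}$ be closed and convex and contain an entrywise positive matrix. Let $E(A)=\langle A,\log A-\mathbf 1\rangle$ if $A\ge0$ (with $0\log0=0$), $E(A)=+\infty$ otherwise, and let $E_{\Sigma_k}=E$ on $\Sigma_k$, $E_{\Sigma_k}=+\infty$ off $\Sigma_k$. Let $\Phi(X,\cdot)$ be a loss on non-negative tensors with values in $(-\infty,+\infty]$, extended by $+\infty$ to all tensors, that is convex and lower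 semicontinuous, and that at each tensor $S[A^{(1)},\dots,A^{(d)}]$ with $A^{(k)}\in\Sigma_k$ entrywise positive is finite and differentiable relative to its effective domain (for instance, $\Phi(X,\cdot)$ finite, smooth and convex on non-negative tensors). Let $f^*(u)=\sup_x\langle x,u\rangle-f(x)$ be the Legendre transform, $\Phi^*(X,\cdot)$ that of $\Phi(X,\cdot)$, and $$\Xi^{(k)}(U)=\Big[U\times_{j\ge k+1}(A^{(j)})^\top\Big]_{(k)}\Big[S\times_{j\le k-1}A^{(j)}\Big]_{(k)}^\top\in\mathbb R^{n_k\times r_k}.$$ Consider the primal and dual problems $$\text{(P)}\ \min_{A^{(k)}\in\mathbb R^{n_k\times r_k}}\Phi(X,S[A^{(1)},\dots,A^{(d)}])+\rho_kE_{\Sigma_k}(A^{(k)}),\qquad \text{(D)}\ \min_{U\in\mathbb R^{n_1\times\cdots\times n_d}}\Phi^*(X,U)+\rho_kE_{\Sigma_k}^*\!\Big(\tfrac{-1}{\rho_k}\Xi^{(k)}(U)\Big).$$ 1. $\Xi^{(k)}$ is linear, and the objective of (D) is convex with values in $(-\infty,+\infty]$. 2. Strong duality holds: both minima are attained and finite,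 and $\min\text{(P)}=-\min\text{(D)}$. 3. Let $U^\star$ be any minimiser of (D). Then (P) has exactly one minimiser $A^{(k)\star}$, and it is also the only maximiser of $A^{(k)}\mapsto\frac{-1}{\rho_k}\langle A^{(k)},\Xi^{(k)}(U^\star)\rangle-E_{\Sigma_k}(A^{(k)})$. With $Z=\exp\big(\frac{-1}{\rho_k}\Xi^{(k)}(U^\star)\big)$ (entrywise), $$A^{(k)\star}=\begin{cases}Z,&\text{no constraint } (\Sigma_k=\mathbb R^{n_k\times r_k}),\\ Z/\langle Z,\mathbf 1\rangle,&\Sigma_k=\{A:\langle A,\mathbf 1\rangle=1\},\\ \mathrm{diag}(Z\mathbf 1)^{-1}Z,&\Sigma_k=\{A:A\mathbf 1=\mathbf 1\},\\ Z\,\mathrm{diag}(Z^\top\mathbf 1)^{-1},&\Sigma_k=\{A:A^\top\mathbf 1=\mathbf 1\}.\end{cases}$$ 4. Suppose $\Sigma_k$ is one of these four sets. Then $U\mapsto E^*_{\Sigma_k}\big(\frac{-1}{\rho_k}\Xi^{(k)}(U)\big)$ is finite and $C^\infty$ on the whole space. On every open set where $\Phi^*(X,\cdot)$ is finite and $C^m$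 ($0\le m\le\infty$), the objective of (D) is finite and $C^m$. Moreover, let $\varepsilon,\lambda>0$ and, for a cost matrix $c$ and non-negative arrays $\alpha,\beta$, let $$\mathrm{OT}^\lambda_\varepsilon(\alpha,\beta)=\inf_{\gamma\ge0,\ \gamma\mathbf 1=\alpha}\ \varepsilon\big\langle\gamma,\log(\gamma/e^{-c/\varepsilon})-\mathbf 1\big\rangle+\lambda\,\mathrm{KL}(\gamma^\top\mathbf 1\,|\,\beta),\qquad \mathrm{KL}(q|\beta)=\langle q,\log(q/\beta)\rangle-\langle q,\mathbf 1\rangle+\langle\beta,\mathbf 1\rangle .$$ (with $0\log0=0$, and $\mathrm{KL}(q|\beta)=+\infty$ if $q_j>0=\beta_j$ for some $j$). If $\Phi(X,\hat X)=\mathrm{OT}^\lambda_\varepsilon(X,\hat X)$ on whole tensors, or $\Phi(X,\hat X)$ is the sum of $\mathrm{OT}^\lambda_\varepsilon$ over the slices of $X,\hat X$ along one mode (with one common cost), then the interior of the effective domain of the objective of (D) is $\{U:U_i<\lambda\text{ for all multi-indices } i\}$, and the objective is $C^\infty$ there. -/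

import Mathlib

open scoped Matrix ContDiff

noncomputable section

namespace TuckerDual

/-! ### Tensors, mode products, matricisation -/

/-- Multi-indices of a tensor of shape `p 0 × ⋯ × p (d-1)`. -/
abbrev Idx {d : ℕ} (p : Fin d → ℕ) : Type := ∀ j, Fin (p j)

/-- Real tensors of shape `p`. -/
abbrev Tensor {d : ℕ} (p : Fin d → ℕ) : Type := Idx p → ℝ

/-- The inner product `∑ i, T i * U i` of two tensors. -/
def tensorInner {d : ℕ} {p : Fin d → ℕ} (T U : Tensor p) : ℝ := ∑ i, T i * U i

/-- The inner product `∑ i j, A i j * B i j` of two matrices. -/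
def matInner {m n : ℕ} (A B : Matrix (Fin m) (Fin n) ℝ) : ℝ := ∑ i, ∑ j, A i j * B i j

/-- The Tucker format `S[A⁽¹⁾, …, A⁽ᵈ⁾]`. -/
def tucker {d : ℕ} {n r : Fin d → ℕ} (S : Tensor r)
    (A : ∀ j, Matrix (Fin (n j)) (Fin (r j)) ℝ) : Tensor n :=
  fun i => ∑ l : Idx r, S l * ∏ j, A j (i j) (l j)

/-- The shape `p` with the sizes of the modes in `J` replaced by those of `q`. -/
def mixedShape {d : ℕ} (J : Finset (Fin d)) (p q : Fin d → ℕ) : Fin d → ℕ :=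
  fun j => if j ∈ J then q j else p j

/-- The mode products `T ×_{j ∈ J} M⁽ʲ⁾`: every mode `j ∈ J` of `T` is contracted with the column
index of `M⁽ʲ⁾`, the other modes are left alone. For `J = {k}` this is the mode-`k` product. -/
def modeProd {d : ℕ} {p q : Fin d → ℕ} (J : Finset (Fin d))
    (M : ∀ j, Matrix (Fin (q j)) (Fin (p j)) ℝ) (T : Tensor p) : Tensor (mixedShape J p q) :=
  fun i => ∑ l : (∀ j : J, Fin (p j)),
    T (fun j => if h : j ∈ J then l ⟨j, h⟩ else Fin.cast (if_neg h) (i j)) *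
      ∏ j : J, M j (Fin.cast (if_pos j.2) (i j)) (l j)

/-- The matricisation `T_(k)`: rows are indexed by mode `k`, columns by all the other modes. -/
def matricise {d : ℕ} {p : Fin d → ℕ} (k : Fin d) (T : Tensor p) :
    Matrix (Fin (p k)) (∀ j : {j : Fin d // j ≠ k}, Fin (p j)) ℝ :=
  fun a c => T (fun j => if h : j = k then Fin.cast (congrArg p h.symm) a else c ⟨j, h⟩)

theorem mixedShape_Ioi_self {d : ℕ} (p q : Fin d → ℕ) (k : Fin d) :
    mixedShape (Finset.Ioi k) p q k = p k := by simp [mixedShape]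

theorem mixedShape_Iio_self {d : ℕ} (p q : Fin d → ℕ) (k : Fin d) :
    mixedShape (Finset.Iio k) p q k = p k := by simp [mixedShape]

theorem mixedShape_ne {d : ℕ} (n r : Fin d → ℕ) (k j : Fin d) (h : j ≠ k) :
    mixedShape (Finset.Iio k) r n j = mixedShape (Finset.Ioi k) n r j := by
  rcases lt_or_gt_of_ne h with h' | h'
  · simp [mixedShape, h', not_lt_of_gt h']
  · simp [mixedShape, h', not_lt_of_gt h']

/-- `Ξ⁽ᵏ⁾(U) = [U ×_{j ≥ k+1} (A⁽ʲ⁾)ᵀ]_(k) [S ×_{j ≤ k-1} A⁽ʲ⁾]_(k)ᵀ`. The two matricisations have the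
same columns (modes `j < k` of size `n j`, modes `j > k` of size `r j`); the casts only record
these equalities of sizes. The matrix `A k` is not used. -/
def Xi {d : ℕ} {n r : Fin d → ℕ} (k : Fin d) (S : Tensor r)
    (A : ∀ j, Matrix (Fin (n j)) (Fin (r j)) ℝ) (U : Tensor n) :
    Matrix (Fin (n k)) (Fin (r k)) ℝ :=
  (matricise k (modeProd (Finset.Ioi k) (fun j => (A j)ᵀ) U)).submatrix
      (Fin.cast (mixedShape_Ioi_self n r k).symm)
      (fun c j => Fin.cast (mixedShape_ne n r k j.1 j.2) (c j)) *
    ((matricise k (modeProd (Finset.Iio k) A S)).submatrix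
      (Fin.cast (mixedShape_Iio_self r n k).symm) id)ᵀ

/-! ### Extended-real convex analysis -/

/-- Convexity of an extended-real function (used for functions that never take the value `⊥`). -/
def EConvex {V : Type*} [AddCommGroup V] [Module ℝ V] (f : V → EReal) : Prop :=
  ∀ x y : V, ∀ a b : ℝ, 0 ≤ a → 0 ≤ b → a + b = 1 →
    f (a • x + b • y) ≤ (a : EReal) * f x + (b : EReal) * f y

/-- The Legendre transform `f*(u) = sup_x ⟨x, u⟩ - f(x)`. -/
def legendre {V : Type*} (pair : V → V → ℝ) (f : V → EReal) (u : V) : EReal :=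
  ⨆ x : V, ((pair x u : ℝ) : EReal) - f x

/-- The indicator `ι(x ∈ Σ)` of convex analysis. -/
def indicator {V : Type*} (C : Set V) (x : V) : EReal :=
  open Classical in if x ∈ C then 0 else ⊤

/-- The entropy `E(α) = ⟨α, log α - 1⟩` on non-negative matrices (with `0 log 0 = 0`), `+∞` on
matrices with a negative entry. -/
def entropy {m n : ℕ} (A : Matrix (Fin m) (Fin n) ℝ) : EReal :=
  open Classical in
  if ∀ i j, 0 ≤ A i j then ((∑ i, ∑ j, A i j * (Real.log (A i j) - 1) : ℝ) : EReal) else ⊤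

/-- `E_Σ(A) = E(A) + ι(A ∈ Σ)`. -/
def entropyOn {m n : ℕ} (C : Set (Matrix (Fin m) (Fin n) ℝ)) (A : Matrix (Fin m) (Fin n) ℝ) :
    EReal :=
  entropy A + indicator C A

/-- A loss `Y ↦ Φ(X, Y)` on non-negative tensors, extended by `+∞` to all tensors. -/
def extLoss {d : ℕ} {n : Fin d → ℕ} (Φ : Tensor n → Tensor n → EReal) (X Y : Tensor n) : EReal :=
  open Classical in if ∀ i, 0 ≤ Y i then Φ X Y else ⊤

/-- `Φ*(X, U)`, the Legendre transform of `Φ` in its second argument. -/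
def lossConj {d : ℕ} {n : Fin d → ℕ} (Φ : Tensor n → Tensor n → EReal) (X U : Tensor n) : EReal :=
  legendre tensorInner (extLoss Φ X) U

/-! ### The constraint sets -/

/-- Fully normalised matrices, `⟨A, 𝟏⟩ = 1`. -/
def totalNormalised (m n : ℕ) : Set (Matrix (Fin m) (Fin n) ℝ) :=
  {A | matInner A (Matrix.of fun _ _ => 1) = 1}

/-- Row-normalised matrices, `A 𝟏 = 𝟏`. -/
def rowNormalised (m n : ℕ) : Set (Matrix (Fin m) (Fin n) ℝ) := {A | A *ᵥ 1 = 1}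

/-- Column-normalised matrices, `Aᵀ 𝟏 = 𝟏`. -/
def colNormalised (m n : ℕ) : Set (Matrix (Fin m) (Fin n) ℝ) := {A | Aᵀ *ᵥ 1 = 1}

/-- One of the four standard constraints: none, or one of the three normalisations. -/
def IsNormalisation {m n : ℕ} (C : Set (Matrix (Fin m) (Fin n) ℝ)) : Prop :=
  C = Set.univ ∨ C = totalNormalised m n ∨ C = rowNormalised m n ∨ C = colNormalised m n

/-! ### Primal, dual and recovery problems for the `k`-th factor -/

/-- `A⁽ᵏ⁾ ↦ Φ(X, S[A⁽¹⁾, …, A⁽ᵈ⁾]) + ρ E_Σ(A⁽ᵏ⁾)`; `B` stands for the variable `A⁽ᵏ⁾`. -/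
def primalObj {d : ℕ} {n r : Fin d → ℕ} (k : Fin d) (Φ : Tensor n → Tensor n → EReal)
    (C : Set (Matrix (Fin (n k)) (Fin (r k)) ℝ)) (ρ : ℝ) (X : Tensor n) (S : Tensor r)
    (A : ∀ j, Matrix (Fin (n j)) (Fin (r j)) ℝ) (B : Matrix (Fin (n k)) (Fin (r k)) ℝ) : EReal :=
  extLoss Φ X (tucker S (Function.update A k B)) + (ρ : EReal) * entropyOn C B

/-- `U ↦ E_Σ*(-Ξ⁽ᵏ⁾(U) / ρ)`. -/
def entropyConj {d : ℕ} {n r : Fin d → ℕ} (k : Fin d)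
    (C : Set (Matrix (Fin (n k)) (Fin (r k)) ℝ)) (ρ : ℝ) (S : Tensor r)
    (A : ∀ j, Matrix (Fin (n j)) (Fin (r j)) ℝ) (U : Tensor n) : EReal :=
  legendre matInner (entropyOn C) ((-1 / ρ) • Xi k S A U)

/-- `U ↦ Φ*(X, U) + ρ E_Σ*(-Ξ⁽ᵏ⁾(U) / ρ)`. -/
def dualObj {d : ℕ} {n r : Fin d → ℕ} (k : Fin d) (Φ : Tensor n → Tensor n → EReal)
    (C : Set (Matrix (Fin (n k)) (Fin (r k)) ℝ)) (ρ : ℝ) (X : Tensor n) (S : Tensor r)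
    (A : ∀ j, Matrix (Fin (n j)) (Fin (r j)) ℝ) (U : Tensor n) : EReal :=
  lossConj Φ X U + (ρ : EReal) * entropyConj k C ρ S A U

/-- `B ↦ -⟨B, Ξ⁽ᵏ⁾(U)⟩ / ρ - E_Σ(B)`. -/
def recoveryObj {d : ℕ} {n r : Fin d → ℕ} (k : Fin d)
    (C : Set (Matrix (Fin (n k)) (Fin (r k)) ℝ)) (ρ : ℝ) (S : Tensor r)
    (A : ∀ j, Matrix (Fin (n j)) (Fin (r j)) ℝ) (U : Tensor n)
    (B : Matrix (Fin (n k)) (Fin (r k)) ℝ) : EReal :=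
  ((-1 / ρ * matInner B (Xi k S A U) : ℝ) : EReal) - entropyOn C B

/-- `Z = exp(-Ξ⁽ᵏ⁾(U) / ρ)`, entrywise. -/
def expFactor {d : ℕ} {n r : Fin d → ℕ} (k : Fin d) (ρ : ℝ) (S : Tensor r)
    (A : ∀ j, Matrix (Fin (n j)) (Fin (r j)) ℝ) (U : Tensor n) :
    Matrix (Fin (n k)) (Fin (r k)) ℝ :=
  ((-1 / ρ) • Xi k S A U).map Real.exp

/-! ### Optimal transport losses -/

/-- The relative entropy `H(γ | K) = ⟨γ, log(γ / K) - 1⟩` (for `γ ≥ 0`, `K > 0`). -/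
def relEntropy {ι : Type*} [Fintype ι] (γ K : ι → ι → ℝ) : ℝ :=
  ∑ i, ∑ j, γ i j * (Real.log (γ i j / K i j) - 1)

/-- The generalised Kullback-Leibler divergence of non-negative vectors. -/
def klDiv {ι : Type*} [Fintype ι] (q b : ι → ℝ) : EReal :=
  open Classical in
  if ∀ j, b j = 0 → q j = 0 then
    (((∑ j, q j * Real.log (q j / b j)) - (∑ j, q j) + ∑ j, b j : ℝ) : EReal)
  else ⊤

/-- Semi-unbalanced entropic optimal transport with cost `c`,
`OT(a, b) = inf {ε H(γ | exp(-c/ε)) + λ KL(γᵀ𝟏 | b) : γ ≥ 0, γ𝟏 = a}`. -/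
def semiOT {ι : Type*} [Fintype ι] (ε lam : ℝ) (c : ι → ι → ℝ) (a b : ι → ℝ) : EReal :=
  ⨅ γ ∈ {γ : ι → ι → ℝ | (∀ i j, 0 ≤ γ i j) ∧ ∀ i, ∑ j, γ i j = a i},
    ((ε * relEntropy γ (fun i j => Real.exp (-c i j / ε)) : ℝ) : EReal) +
      (lam : EReal) * klDiv (fun j => ∑ i, γ i j) b

/-- `Φ(X, ·)` is, on non-negative tensors, one of the optimal transport losses: the transport
cost between whole tensors, or the sum of the transport costs between the slices along a mode. -/
def IsOTLoss {d : ℕ} {n : Fin d → ℕ} (ε lam : ℝ) (Φ : Tensor n → Tensor n → EReal)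
    (X : Tensor n) : Prop :=
  (∃ c : Idx n → Idx n → ℝ, ∀ Y : Tensor n, (∀ i, 0 ≤ Y i) → Φ X Y = semiOT ε lam c X Y) ∨
  (∃ s : Fin d, ∃ c : (∀ j : {j : Fin d // j ≠ s}, Fin (n j)) →
      (∀ j : {j : Fin d // j ≠ s}, Fin (n j)) → ℝ,
    ∀ Y : Tensor n, (∀ i, 0 ≤ Y i) →
      Φ X Y = ∑ i, semiOT ε lam c (matricise s X i) (matricise s Y i))

end TuckerDual

end

open TuckerDual

noncomputable section

namespace TuckerDual

/-! ### Multilinear algebra: `Ξ⁽ᵏ⁾` is the adjoint of the Tucker format in its `k`-th factor -/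

section Tucker

variable {d : ℕ} {n r : Fin d → ℕ}

/-! This is Fenchel–Rockafellar duality, with the dual certificate constructed directly and no
separation theorem. In its `k`-th factor the Tucker format is a linear map `L` (`tuckerLin`), and
`Xi` is its adjoint (`tensorInner_tucker_update`). Weak duality is then the Fenchel–Young inequality
used twice, once for the loss and once for the entropy (`neg_le_dual`).

For strong duality, differentiability at a positive feasible factor gives the convex loss an affine
minorant. The entropy is coercive against it, so a primal minimiser `B` exists
(`exists_isMinOn_add_entropyOn`). Since `x log x` has slope `-∞` at `0`, `B` is entrywise positive
(`pos_of_isMinOn_add_entropyOn`), hence the loss is differentiable at `L B`. Its gradient `U` there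
is dual optimal: the subgradient inequality gives equality in the first Young inequality, and
first-order optimality of `B` gives it in the second (`exists_primal_dual`).

Conversely, a zero duality gap forces both Young inequalities to be tight. Every primal minimiser
therefore solves the recovery problem of every dual minimiser, and strict convexity of the entropy
leaves a single candidate (`eq_of_isMaxOn_sub_entropyOn`). For the four standard constraints this
candidate is the exponential of `V - N`, where `V = -Ξ(U)/ρ` and `N` is a log-sum-exp multiplier
whose inner product with elements of the constraint set is constant. The same formula shows that the
entropy term is smooth.

For transport losses the conjugate is computed in closed form on `{U < λ}`. It is `+∞` as soon as
some `U i > λ`, because the loss grows at rate at most `λ` along rays from `X`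
(`IsOTLoss.lossConj_eq`). -/

theorem tucker_update (k : Fin d) (S : Tensor r) (A : ∀ j, Matrix (Fin (n j)) (Fin (r j)) ℝ)
    (B : Matrix (Fin (n k)) (Fin (r k)) ℝ) (i : Idx n) :
    tucker S (Function.update A k B) i =
      ∑ l : Idx r, S l * (B (i k) (l k) * ∏ j ∈ Finset.univ.erase k, A j (i j) (l j)) := by
  unfold tucker
  refine Finset.sum_congr rfl fun l _ => ?_
  rw [← Finset.mul_prod_erase Finset.univ _ (Finset.mem_univ k), Function.update_self]
  congr 2
  refine Finset.prod_congr rfl fun j hj => ?_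
  rw [Function.update_of_ne (Finset.ne_of_mem_erase hj)]

/-- The Tucker format as a linear map in the `k`-th factor. -/
def tuckerLin (k : Fin d) (S : Tensor r) (A : ∀ j, Matrix (Fin (n j)) (Fin (r j)) ℝ) :
    Matrix (Fin (n k)) (Fin (r k)) ℝ →ₗ[ℝ] Tensor n where
  toFun B := tucker S (Function.update A k B)
  map_add' B B' := by
    funext i
    simp only [tucker_update, Pi.add_apply, Matrix.add_apply, ← Finset.sum_add_distrib]
    exact Finset.sum_congr rfl fun l _ => by ring
  map_smul' a B := by
    funext i
    simp only [tucker_update, Pi.smul_apply, Matrix.smul_apply, smul_eq_mul, RingHom.id_apply,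
      Finset.mul_sum]
    exact Finset.sum_congr rfl fun l _ => by ring

theorem prod_erase_eq_Ioi_mul_Iio (k : Fin d) (f : Fin d → ℝ) :
    ∏ j ∈ Finset.univ.erase k, f j = (∏ j ∈ Finset.Ioi k, f j) * ∏ j ∈ Finset.Iio k, f j := by
  rw [← Finset.prod_union]
  · refine Finset.prod_congr ?_ fun _ _ => rfl
    ext j
    simp only [Finset.mem_erase, Finset.mem_univ, and_true, Finset.mem_union, Finset.mem_Ioi,
      Finset.mem_Iio]
    rw [ne_iff_lt_or_gt, or_comm]
  · rw [Finset.disjoint_left]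
    intro j hj hj'
    exact lt_asymm (Finset.mem_Ioi.1 hj) (Finset.mem_Iio.1 hj')

/-- The column indices of the two matricisations in `Ξ⁽ᵏ⁾`. -/
abbrev XiCol (n r : Fin d → ℕ) (k : Fin d) : Type :=
  ∀ j : {j : Fin d // j ≠ k}, Fin (mixedShape (Finset.Iio k) r n j)

/-- A pair of multi-indices, split into the entries at `k`, the common columns of the two
matricisations in `Ξ⁽ᵏ⁾`, and the contracted entries. -/
def splitIdx (n r : Fin d → ℕ) (k : Fin d) :
    (Idx n × Idx r) ≃ (Fin (n k) × Fin (r k)) × XiCol n r k ×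
      (∀ j : Finset.Ioi k, Fin (n j)) × (∀ j : Finset.Iio k, Fin (r j)) where
  toFun x := ((x.1 k, x.2 k), fun j => if h : j.1 ∈ Finset.Iio k
      then Fin.cast (if_pos h).symm (x.1 j) else Fin.cast (if_neg h).symm (x.2 j),
    fun j => x.1 j, fun j => x.2 j)
  -- Modes after `k` are contracted on the `n` side and modes before `k` on the `r` side. The
  -- remaining entries are read from the shared column, whose size is `n j` for `j < k` and `r j`
  -- for `j > k`.
  invFun y := (
    fun j => if h : j ∈ Finset.Ioi k then y.2.2.1 ⟨j, h⟩ else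
      if h' : j = k then Fin.cast (congrArg n h'.symm) y.1.1 else
        Fin.cast (if_pos (by
          simp only [Finset.mem_Ioi, Finset.mem_Iio] at h ⊢
          exact lt_of_le_of_ne (not_lt.1 h) h')) (y.2.1 ⟨j, h'⟩),
    fun j => if h : j ∈ Finset.Iio k then y.2.2.2 ⟨j, h⟩ else
      if h' : j = k then Fin.cast (congrArg r h'.symm) y.1.2 else
        Fin.cast (if_neg h) (y.2.1 ⟨j, h'⟩))
  left_inv x := by
    ext j
    · by_cases h : j ∈ Finset.Ioi k
      · simp [h]
      · by_cases h' : j = k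
        · subst h'; simp
        · have h2 : j ∈ Finset.Iio k := by
            simp only [Finset.mem_Ioi, Finset.mem_Iio] at h ⊢
            exact lt_of_le_of_ne (not_lt.1 h) h'
          simp [h, h', h2]
          rfl
    · by_cases h : j ∈ Finset.Iio k
      · simp [h]
      · by_cases h' : j = k
        · subst h'; simp
        · simp [h, h']
          rfl
  right_inv y := by
    obtain ⟨⟨a, b⟩, c, l, l'⟩ := y
    refine Prod.ext (Prod.ext ?_ ?_) (Prod.ext ?_ (Prod.ext ?_ ?_))
    · simp
    · simp
    · funext ⟨j, hj⟩
      apply Fin.ext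
      by_cases h : j ∈ Finset.Iio k
      · have h2 : j ∉ Finset.Ioi k := by
          simp only [Finset.mem_Ioi, Finset.mem_Iio] at h ⊢
          exact lt_asymm h
        simp [h, hj, h2]
        rfl
      · simp [h, hj]
        rfl
    · funext ⟨j, hj⟩
      simp [hj]
    · funext ⟨j, hj⟩
      simp [hj]

theorem splitIdx_symm_fst_of_mem (k : Fin d) (y) {j : Fin d} (h : j ∈ Finset.Ioi k) :
    ((splitIdx n r k).symm y).1 j = y.2.2.1 ⟨j, h⟩ := dif_pos h

theorem splitIdx_symm_snd_of_mem (k : Fin d) (y) {j : Fin d} (h : j ∈ Finset.Iio k) :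
    ((splitIdx n r k).symm y).2 j = y.2.2.2 ⟨j, h⟩ := dif_pos h

/-- Stated in `ℕ` because the sizes on the two sides agree only propositionally. -/
theorem splitIdx_symm_fst_of_notMem (k : Fin d) (y) {j : Fin d} (h : j ∉ Finset.Ioi k)
    (h' : j ≠ k) : (((splitIdx n r k).symm y).1 j : ℕ) = y.2.1 ⟨j, h'⟩ := by
  simp only [splitIdx, Equiv.coe_fn_symm_mk]
  rw [dif_neg h, dif_neg h']
  rfl

theorem splitIdx_symm_snd_of_notMem (k : Fin d) (y) {j : Fin d} (h : j ∉ Finset.Iio k)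
    (h' : j ≠ k) : (((splitIdx n r k).symm y).2 j : ℕ) = y.2.1 ⟨j, h'⟩ := by
  simp only [splitIdx, Equiv.coe_fn_symm_mk]
  rw [dif_neg h, dif_neg h']
  rfl

theorem Xi_apply_eq_sum (k : Fin d) (S : Tensor r)
    (A : ∀ j, Matrix (Fin (n j)) (Fin (r j)) ℝ) (U : Tensor n) (a : Fin (n k)) (b : Fin (r k)) :
    Xi k S A U a b = ∑ c : XiCol n r k,
      matricise k (modeProd (Finset.Ioi k) (fun j => (A j)ᵀ) U)
        (Fin.cast (mixedShape_Ioi_self n r k).symm a)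
        (fun j => Fin.cast (mixedShape_ne n r k j.1 j.2) (c j)) *
      matricise k (modeProd (Finset.Iio k) A S) (Fin.cast (mixedShape_Iio_self r n k).symm b) c :=
  rfl

/-- Both sides are one sum over pairs of multi-indices, reordered by `splitIdx`. The product over `j
≠ k` splits into the modes after `k`, which `Xi` contracts with `U`, and those before `k`, which it
contracts with `S`. -/
theorem tensorInner_tucker_update (k : Fin d) (S : Tensor r)
    (A : ∀ j, Matrix (Fin (n j)) (Fin (r j)) ℝ) (B : Matrix (Fin (n k)) (Fin (r k)) ℝ)
    (U : Tensor n) :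
    tensorInner (tucker S (Function.update A k B)) U = matInner B (Xi k S A U) := by
  have hL : tensorInner (tucker S (Function.update A k B)) U = ∑ x : Idx n × Idx r,
      U x.1 * S x.2 * B (x.1 k) (x.2 k) *
        ((∏ j ∈ Finset.Ioi k, A j (x.1 j) (x.2 j)) * ∏ j ∈ Finset.Iio k, A j (x.1 j) (x.2 j)) := by
    rw [Fintype.sum_prod_type]
    unfold tensorInner
    refine Finset.sum_congr rfl fun i _ => ?_
    rw [tucker_update, Finset.sum_mul]
    refine Finset.sum_congr rfl fun l _ => ?_
    rw [prod_erase_eq_Ioi_mul_Iio]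
    ring
  rw [hL, ← (splitIdx n r k).symm.sum_comp, Fintype.sum_prod_type, Fintype.sum_prod_type]
  unfold matInner
  refine Finset.sum_congr rfl fun a _ => Finset.sum_congr rfl fun b _ => ?_
  rw [Xi_apply_eq_sum, Fintype.sum_prod_type, Finset.mul_sum]
  refine Finset.sum_congr rfl fun c _ => ?_
  simp only [matricise, modeProd]
  rw [Finset.sum_mul_sum, Finset.mul_sum, Fintype.sum_prod_type]
  refine Finset.sum_congr rfl fun l _ => ?_
  rw [Finset.mul_sum]
  refine Finset.sum_congr rfl fun l' _ => ?_
  rw [← Finset.prod_coe_sort (Finset.Ioi k), ← Finset.prod_coe_sort (Finset.Iio k)]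
  have hk1 : ((splitIdx n r k).symm ((a, b), c, l, l')).1 k = a := by simp [splitIdx]
  have hk2 : ((splitIdx n r k).symm ((a, b), c, l, l')).2 k = b := by simp [splitIdx]
  rw [hk1, hk2]
  -- Reduces the summands to four matching factors: the entry of `U`, the entry of `S`, and the
  -- products after and before `k`.
  have e1 : ∀ x1 x2 x3 x4 y1 y2 y3 y4 b : ℝ, x1 = y1 → x2 = y2 → x3 = y3 → x4 = y4 →
      x1 * x2 * b * (x3 * x4) = b * (y1 * y3 * (y2 * y4)) := by
    rintro _ _ _ _ _ _ _ _ b rfl rfl rfl rfl; ring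
  refine e1 _ _ _ _ _ _ _ _ _ ?_ ?_ ?_ ?_
  · congr 1
    funext j
    apply Fin.ext
    by_cases h : j ∈ Finset.Ioi k
    · rw [splitIdx_symm_fst_of_mem _ _ h, dif_pos h]
    · rw [dif_neg h]
      by_cases h' : j = k
      · subst h'
        rw [hk1]
        simp only [dite_true]
        rfl
      · rw [splitIdx_symm_fst_of_notMem _ _ h h', dif_neg h']
        rfl
  · congr 1
    funext j
    apply Fin.ext
    by_cases h : j ∈ Finset.Iio k
    · rw [splitIdx_symm_snd_of_mem _ _ h, dif_pos h]
    · rw [dif_neg h]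
      by_cases h' : j = k
      · subst h'
        rw [hk2]
        simp only [dite_true]
        rfl
      · rw [splitIdx_symm_snd_of_notMem _ _ h h', dif_neg h']
        rfl
  · refine Finset.prod_congr rfl fun j _ => ?_
    obtain ⟨j, hj⟩ := j
    have h1 : j ∉ Finset.Iio k := by
      simp only [Finset.mem_Ioi, Finset.mem_Iio] at hj ⊢
      exact lt_asymm hj
    have h2 : j ≠ k := ne_of_gt (Finset.mem_Ioi.1 hj)
    rw [Matrix.transpose_apply]
    congr 1 <;> apply Fin.ext
    · rw [splitIdx_symm_fst_of_mem _ _ hj]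
    · rw [splitIdx_symm_snd_of_notMem _ _ h1 h2, dif_neg h2]
      rfl
  · refine Finset.prod_congr rfl fun j _ => ?_
    obtain ⟨j, hj⟩ := j
    have h1 : j ∉ Finset.Ioi k := by
      simp only [Finset.mem_Ioi, Finset.mem_Iio] at hj ⊢
      exact lt_asymm hj
    have h2 : j ≠ k := ne_of_lt (Finset.mem_Iio.1 hj)
    congr 1 <;> apply Fin.ext
    · rw [splitIdx_symm_fst_of_notMem _ _ h1 h2, dif_neg h2]
      rfl
    · rw [splitIdx_symm_snd_of_mem _ _ hj]

/-- The adjoint identity tested on matrix units. It makes linearity and smoothness of `Xi` visible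
without unfolding matricisations. -/
theorem Xi_apply (k : Fin d) (S : Tensor r) (A : ∀ j, Matrix (Fin (n j)) (Fin (r j)) ℝ)
    (U : Tensor n) (a : Fin (n k)) (b : Fin (r k)) :
    Xi k S A U a b =
      tensorInner (tucker S (Function.update A k (Matrix.single a b 1))) U := by
  rw [tensorInner_tucker_update]
  unfold matInner
  rw [Finset.sum_eq_single a, Finset.sum_eq_single b]
  · simp
  · intro j _ hj; simp [hj.symm]
  · simp
  · intro i _ hi; simp [hi.symm]
  · simp

theorem isLinearMap_Xi (k : Fin d) (S : Tensor r) (A : ∀ j, Matrix (Fin (n j)) (Fin (r j)) ℝ) :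
    IsLinearMap ℝ (Xi (n := n) k S A) where
  map_add U V := by
    ext a b
    simp only [Xi_apply, Matrix.add_apply, tensorInner, Pi.add_apply, mul_add,
      Finset.sum_add_distrib]
  map_smul t U := by
    ext a b
    simp only [Xi_apply, Matrix.smul_apply, tensorInner, Pi.smul_apply, smul_eq_mul,
      Finset.mul_sum]
    exact Finset.sum_congr rfl fun l _ => by ring

theorem contDiff_Xi_apply (k : Fin d) (S : Tensor r)
    (A : ∀ j, Matrix (Fin (n j)) (Fin (r j)) ℝ) (a : Fin (n k)) (b : Fin (r k)) :
    ContDiff ℝ ∞ fun U : Tensor n => Xi k S A U a b := by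
  simp only [Xi_apply, tensorInner]
  fun_prop

end Tucker

/-! ### Extended-real convex functions -/

section EConvex

variable {V : Type*} {pair : V → V → ℝ} {f g : V → EReal}

theorem le_legendre (z u : V) : ((pair z u : ℝ) : EReal) - f z ≤ legendre pair f u :=
  le_iSup (fun x => ((pair x u : ℝ) : EReal) - f x) z

theorem legendre_ne_bot {z : V} (hz : f z ≠ ⊤) (u : V) : legendre pair f u ≠ ⊥ := by
  intro h
  have h1 := le_legendre (pair := pair) (f := f) z u
  rw [h, le_bot_iff, sub_eq_add_neg, EReal.add_eq_bot_iff] at h1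
  rcases h1 with h1 | h1
  · exact EReal.coe_ne_bot _ h1
  · exact hz (EReal.neg_eq_bot_iff.1 h1)

variable [AddCommGroup V] [Module ℝ V]

theorem econvex_legendre (hf : ∀ z, f z ≠ ⊥)
    (hpair : ∀ z x y : V, ∀ a b : ℝ, pair z (a • x + b • y) = a * pair z x + b * pair z y) :
    EConvex (legendre pair f) := by
  intro x y a b ha hb hab
  refine iSup_le fun z => ?_
  have hx := le_legendre (pair := pair) (f := f) z x
  have hy := le_legendre (pair := pair) (f := f) z y
  have ha' : (0 : EReal) ≤ a := EReal.coe_nonneg.2 ha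
  have hb' : (0 : EReal) ≤ b := EReal.coe_nonneg.2 hb
  refine le_trans ?_ (add_le_add (mul_le_mul_of_nonneg_left hx ha')
    (mul_le_mul_of_nonneg_left hy hb'))
  generalize hc : f z = c
  induction c with
  | bot => exact absurd hc (hf z)
  | top => simp
  | coe c =>
    norm_cast
    rw [hpair, show b = 1 - a by linarith]
    apply le_of_eq
    ring

theorem EConvex.add (hf : EConvex f) (hg : EConvex g) : EConvex fun x => f x + g x := by
  intro x y a b ha hb hab
  refine (add_le_add (hf x y a b ha hb hab) (hg x y a b ha hb hab)).trans_eq ?_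
  rw [EReal.left_distrib_of_nonneg_of_ne_top (EReal.coe_nonneg.2 ha) (EReal.coe_ne_top a),
    EReal.left_distrib_of_nonneg_of_ne_top (EReal.coe_nonneg.2 hb) (EReal.coe_ne_top b),
    add_add_add_comm]

theorem EConvex.const_mul (hf : EConvex f) {c : ℝ} (hc : 0 ≤ c) :
    EConvex fun x => (c : EReal) * f x := by
  intro x y a b ha hb hab
  have hc' : (0 : EReal) ≤ c := EReal.coe_nonneg.2 hc
  refine (mul_le_mul_of_nonneg_left (hf x y a b ha hb hab) hc').trans_eq ?_
  rw [EReal.left_distrib_of_nonneg_of_ne_top hc' (EReal.coe_ne_top c),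
    mul_left_comm, mul_left_comm (c : EReal)]

theorem EConvex.comp_isLinearMap {W : Type*} [AddCommGroup W] [Module ℝ W] (hf : EConvex f)
    {T : W → V} (hT : IsLinearMap ℝ T) : EConvex fun x => f (T x) := by
  intro x y a b ha hb hab
  simp only [hT.map_add, hT.map_smul]
  exact hf _ _ a b ha hb hab

end EConvex

/-! ### The entropy -/

/-- The scalar Fenchel–Young inequality: `exp` is the conjugate of `b (log b - 1)`. It is `x + 1 ≤
exp x` at `x = v - log b`. -/
theorem mul_sub_mul_log_le_exp {b : ℝ} (hb : 0 ≤ b) (v : ℝ) :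
    b * v - b * (Real.log b - 1) ≤ Real.exp v := by
  rcases hb.eq_or_lt with rfl | hb
  · simpa using (Real.exp_pos v).le
  · have h := Real.add_one_le_exp (v - Real.log b)
    rw [Real.exp_sub, Real.exp_log hb, le_div_iff₀ hb] at h
    linarith

theorem mul_log_sub_one_convex {x y : ℝ} (hx : 0 ≤ x) (hy : 0 ≤ y) {s t : ℝ} (hs : 0 ≤ s)
    (ht : 0 ≤ t) (hst : s + t = 1) :
    (s * x + t * y) * (Real.log (s * x + t * y) - 1) ≤
      s * (x * (Real.log x - 1)) + t * (y * (Real.log y - 1)) := by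
  have h := Real.convexOn_mul_log.2 (x := x) (y := y) hx hy hs ht hst
  simp only [smul_eq_mul] at h
  nlinarith

theorem mul_log_sub_one_midpoint_lt {x y : ℝ} (hx : 0 ≤ x) (hy : 0 ≤ y) (hxy : x ≠ y) :
    (1 / 2 * x + 1 / 2 * y) * (Real.log (1 / 2 * x + 1 / 2 * y) - 1) <
      1 / 2 * (x * (Real.log x - 1)) + 1 / 2 * (y * (Real.log y - 1)) := by
  have h := Real.strictConvexOn_mul_log.2 (x := x) (y := y) hx hy hxy
    (show (0 : ℝ) < 1 / 2 by norm_num) (show (0 : ℝ) < 1 / 2 by norm_num) (by norm_num)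
  simp only [smul_eq_mul] at h
  nlinarith

section Entropy

variable {m n : ℕ} {C : Set (Matrix (Fin m) (Fin n) ℝ)}

/-- The value of the entropy on non-negative matrices. -/
def entropyVal (B : Matrix (Fin m) (Fin n) ℝ) : ℝ := ∑ i, ∑ j, B i j * (Real.log (B i j) - 1)

theorem entropyOn_of_mem {B : Matrix (Fin m) (Fin n) ℝ} (hB : B ∈ C) (h0 : ∀ i j, 0 ≤ B i j) :
    entropyOn C B = (entropyVal B : EReal) := by
  simp [entropyOn, entropy, indicator, hB, h0, entropyVal]

theorem entropyOn_eq_top {B : Matrix (Fin m) (Fin n) ℝ} (hB : ¬ (B ∈ C ∧ ∀ i j, 0 ≤ B i j)) :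
    entropyOn C B = ⊤ := by
  unfold entropyOn entropy indicator
  by_cases h : ∀ i j, 0 ≤ B i j
  · have hC : B ∉ C := fun h' => hB ⟨h', h⟩
    rw [if_neg hC, if_pos h, EReal.coe_add_top]
  · rw [if_neg h]
    by_cases hC : B ∈ C
    · rw [if_pos hC, add_zero]
    · rw [if_neg hC, EReal.top_add_top]

theorem entropyOn_ne_bot (B : Matrix (Fin m) (Fin n) ℝ) : entropyOn C B ≠ ⊥ := by
  by_cases h : B ∈ C ∧ ∀ i j, 0 ≤ B i j
  · rw [entropyOn_of_mem h.1 h.2]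
    exact EReal.coe_ne_bot _
  · rw [entropyOn_eq_top h]
    exact bot_ne_top.symm

theorem matInner_add_smul_right (B V W : Matrix (Fin m) (Fin n) ℝ) (a b : ℝ) :
    matInner B (a • V + b • W) = a * matInner B V + b * matInner B W := by
  simp only [matInner, Matrix.add_apply, Matrix.smul_apply, smul_eq_mul, Finset.mul_sum,
    ← Finset.sum_add_distrib]
  exact Finset.sum_congr rfl fun i _ => Finset.sum_congr rfl fun j _ => by ring

theorem matInner_smul_right (B V : Matrix (Fin m) (Fin n) ℝ) (a : ℝ) :
    matInner B (a • V) = a * matInner B V := by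
  simpa using matInner_add_smul_right B V 0 a 0

theorem matInner_add_smul_left (B B' V : Matrix (Fin m) (Fin n) ℝ) (a b : ℝ) :
    matInner (a • B + b • B') V = a * matInner B V + b * matInner B' V := by
  simp only [matInner, Matrix.add_apply, Matrix.smul_apply, smul_eq_mul, Finset.mul_sum,
    ← Finset.sum_add_distrib]
  exact Finset.sum_congr rfl fun i _ => Finset.sum_congr rfl fun j _ => by ring

theorem entropyVal_midpoint_lt {B B' : Matrix (Fin m) (Fin n) ℝ} (hB : ∀ i j, 0 ≤ B i j)
    (hB' : ∀ i j, 0 ≤ B' i j) (hne : B ≠ B') :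
    entropyVal ((1 / 2 : ℝ) • B + (1 / 2 : ℝ) • B') <
      1 / 2 * entropyVal B + 1 / 2 * entropyVal B' := by
  obtain ⟨i, j, hij⟩ : ∃ i j, B i j ≠ B' i j := by
    by_contra! h
    exact hne (Matrix.ext h)
  simp only [entropyVal, Matrix.add_apply, Matrix.smul_apply, smul_eq_mul, Finset.mul_sum,
    ← Finset.sum_add_distrib]
  have hle : ∀ a b, (1 / 2 * B a b + 1 / 2 * B' a b) *
      (Real.log (1 / 2 * B a b + 1 / 2 * B' a b) - 1) ≤
      1 / 2 * (B a b * (Real.log (B a b) - 1)) + 1 / 2 * (B' a b * (Real.log (B' a b) - 1)) :=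
    fun a b => mul_log_sub_one_convex (hB a b) (hB' a b) (by norm_num) (by norm_num)
      (by norm_num)
  refine Finset.sum_lt_sum (fun a _ => Finset.sum_le_sum fun b _ => hle a b)
    ⟨i, Finset.mem_univ i, Finset.sum_lt_sum (fun b _ => hle i b) ⟨j, Finset.mem_univ j, ?_⟩⟩
  exact mul_log_sub_one_midpoint_lt (hB i j) (hB' i j) hij

theorem matInner_sub_entropyVal_le {B : Matrix (Fin m) (Fin n) ℝ} (hB : ∀ i j, 0 ≤ B i j)
    (V : Matrix (Fin m) (Fin n) ℝ) :
    matInner B V - entropyVal B ≤ ∑ i, ∑ j, Real.exp (V i j) := by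
  simp only [matInner, entropyVal, ← Finset.sum_sub_distrib]
  exact Finset.sum_le_sum fun i _ => Finset.sum_le_sum fun j _ =>
    mul_sub_mul_log_le_exp (hB i j) _

theorem matInner_sub_entropyVal_exp (V : Matrix (Fin m) (Fin n) ℝ) :
    matInner (V.map Real.exp) V - entropyVal (V.map Real.exp) = ∑ i, ∑ j, Real.exp (V i j) := by
  simp only [matInner, entropyVal, ← Finset.sum_sub_distrib, Matrix.map_apply, Real.log_exp]
  exact Finset.sum_congr rfl fun i _ => Finset.sum_congr rfl fun j _ => by ring

/-- If subtracting `N`, which is constant on `C`, normalises the exponential of `V` to an element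
of `C`, that element is the maximiser in the definition of `E_C*(V)`. -/
theorem sub_entropyOn_le_of_normalised {V N : Matrix (Fin m) (Fin n) ℝ} {ν : ℝ}
    (hN : ∀ B ∈ C, matInner B N = ν) (B : Matrix (Fin m) (Fin n) ℝ) :
    ((matInner B V : ℝ) : EReal) - entropyOn C B ≤
      ((ν + ∑ i, ∑ j, Real.exp (V i j - N i j) : ℝ) : EReal) := by
  by_cases h : B ∈ C ∧ ∀ i j, 0 ≤ B i j
  · rw [entropyOn_of_mem h.1 h.2]
    norm_cast
    have h1 := matInner_sub_entropyVal_le h.2 (V - N)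
    have h2 := matInner_add_smul_right B V N 1 (-1)
    rw [one_smul, neg_one_smul, ← sub_eq_add_neg, hN B h.1] at h2
    simp only [Matrix.sub_apply] at h1
    linarith
  · rw [entropyOn_eq_top h]
    simp

/-- Young's inequality is an equality at the exponential, so the preceding upper bound is attained.
-/
theorem sub_entropyOn_eq_of_normalised {V N : Matrix (Fin m) (Fin n) ℝ} {ν : ℝ}
    (hN : ∀ B ∈ C, matInner B N = ν) (hZ : (V - N).map Real.exp ∈ C) :
    ((matInner ((V - N).map Real.exp) V : ℝ) : EReal) - entropyOn C ((V - N).map Real.exp) =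
      ((ν + ∑ i, ∑ j, Real.exp (V i j - N i j) : ℝ) : EReal) := by
  rw [entropyOn_of_mem hZ fun i j => (Real.exp_pos _).le]
  norm_cast
  have h1 := matInner_sub_entropyVal_exp (V - N)
  have h2 := matInner_add_smul_right ((V - N).map Real.exp) V N 1 (-1)
  rw [one_smul, neg_one_smul, ← sub_eq_add_neg, hN _ hZ] at h2
  simp only [Matrix.sub_apply] at h1
  linarith

theorem legendre_entropyOn_of_normalised {V N : Matrix (Fin m) (Fin n) ℝ} {ν : ℝ}
    (hN : ∀ B ∈ C, matInner B N = ν) (hZ : (V - N).map Real.exp ∈ C) :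
    legendre matInner (entropyOn C) V =
      ((ν + ∑ i, ∑ j, Real.exp (V i j - N i j) : ℝ) : EReal) :=
  le_antisymm (iSup_le fun B => sub_entropyOn_le_of_normalised hN B)
    ((sub_entropyOn_eq_of_normalised hN hZ).ge.trans (le_legendre _ _))

/-- Strict concavity: the midpoint of two distinct maximisers would beat them. The feasible `B₀`
keeps the maximum above `⊥`, so maximisers are feasible. -/
theorem eq_of_isMaxOn_sub_entropyOn (hC : Convex ℝ C) {V B B' B₀ : Matrix (Fin m) (Fin n) ℝ}
    (hB₀ : B₀ ∈ C) (h₀ : ∀ i j, 0 ≤ B₀ i j)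
    (hB : IsMaxOn (fun B => ((matInner B V : ℝ) : EReal) - entropyOn C B) Set.univ B)
    (hB' : IsMaxOn (fun B => ((matInner B V : ℝ) : EReal) - entropyOn C B) Set.univ B') :
    B = B' := by
  have key : ∀ D : Matrix (Fin m) (Fin n) ℝ,
      IsMaxOn (fun B => ((matInner B V : ℝ) : EReal) - entropyOn C B) Set.univ D →
      D ∈ C ∧ ∀ i j, 0 ≤ D i j := by
    intro D hD
    by_contra h
    have h1 := hD (Set.mem_univ B₀)
    simp only [Set.mem_ofPred_eq, entropyOn_eq_top h, entropyOn_of_mem hB₀ h₀, EReal.sub_top,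
      le_bot_iff] at h1
    exact EReal.coe_ne_bot _ h1
  obtain ⟨hBC, hB0⟩ := key B hB
  obtain ⟨hBC', hB0'⟩ := key B' hB'
  by_contra hne
  have hlt := entropyVal_midpoint_lt hB0 hB0' hne
  have hM : (1 / 2 : ℝ) • B + (1 / 2 : ℝ) • B' ∈ C :=
    hC hBC hBC' (by norm_num) (by norm_num) (by norm_num)
  have hM0 : ∀ i j, 0 ≤ ((1 / 2 : ℝ) • B + (1 / 2 : ℝ) • B') i j := fun i j => by
    simp only [Matrix.add_apply, Matrix.smul_apply, smul_eq_mul]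
    linarith [hB0 i j, hB0' i j]
  have h1 := hB (Set.mem_univ ((1 / 2 : ℝ) • B + (1 / 2 : ℝ) • B'))
  have h2 := hB' (Set.mem_univ ((1 / 2 : ℝ) • B + (1 / 2 : ℝ) • B'))
  simp only [Set.mem_ofPred_eq, entropyOn_of_mem hM hM0, entropyOn_of_mem hBC hB0,
    entropyOn_of_mem hBC' hB0', matInner_add_smul_left] at h1 h2
  norm_cast at h1 h2
  linarith

/-! ### The four standard constraints -/

theorem sum_exp_pos {ι : Type*} [Fintype ι] [Nonempty ι] (v : ι → ℝ) : 0 < ∑ i, Real.exp (v i) :=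
  Finset.sum_pos (fun _ _ => Real.exp_pos _) Finset.univ_nonempty

theorem totalNormalised_nonempty_iff {B : Matrix (Fin m) (Fin n) ℝ} (hB : B ∈ totalNormalised m n) :
    Nonempty (Fin m) ∧ Nonempty (Fin n) := by
  constructor
  all_goals
    by_contra h
    rw [not_nonempty_iff] at h
    simp [totalNormalised, matInner] at hB

/-- Subtracting the logarithm of the total mass in the exponent is division by that mass. This links
the multiplier form `V - N` to the closed formula. The member `B` excludes empty index types, for
which the mass would vanish. -/
theorem exp_mem_totalNormalised {B : Matrix (Fin m) (Fin n) ℝ} (hB : B ∈ totalNormalised m n)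
    (V : Matrix (Fin m) (Fin n) ℝ) :
    0 < ∑ i, ∑ j, Real.exp (V i j) ∧
    (V - Matrix.of fun _ _ => Real.log (∑ i, ∑ j, Real.exp (V i j))).map Real.exp =
      (∑ i, ∑ j, Real.exp (V i j))⁻¹ • V.map Real.exp ∧
    (∑ i, ∑ j, Real.exp (V i j))⁻¹ • V.map Real.exp ∈ totalNormalised m n := by
  obtain ⟨_, _⟩ := totalNormalised_nonempty_iff hB
  have hpos : 0 < ∑ i, ∑ j, Real.exp (V i j) :=
    Finset.sum_pos (fun i _ => sum_exp_pos _) Finset.univ_nonempty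
  refine ⟨hpos, ?_, ?_⟩
  · ext i j
    simp only [Matrix.map_apply, Matrix.sub_apply, Matrix.of_apply, Matrix.smul_apply,
      Real.exp_sub, Real.exp_log hpos, smul_eq_mul]
    rw [div_eq_inv_mul]
  · simp only [totalNormalised, Set.mem_ofPred_eq, matInner, Matrix.smul_apply, Matrix.map_apply,
      Matrix.of_apply, mul_one, smul_eq_mul, ← Finset.mul_sum]
    exact inv_mul_cancel₀ hpos.ne'

theorem mem_rowNormalised {B : Matrix (Fin m) (Fin n) ℝ} :
    B ∈ rowNormalised m n ↔ ∀ i, ∑ j, B i j = 1 := by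
  simp [rowNormalised, funext_iff, Matrix.mulVec, dotProduct]

theorem mem_colNormalised {B : Matrix (Fin m) (Fin n) ℝ} :
    B ∈ colNormalised m n ↔ ∀ j, ∑ i, B i j = 1 := by
  simp [colNormalised, funext_iff, Matrix.mulVec, dotProduct]

theorem diagonal_inv_mul_apply {v : Fin m → ℝ} (hv : ∀ i, v i ≠ 0) (B : Matrix (Fin m) (Fin n) ℝ)
    (i : Fin m) (j : Fin n) : ((Matrix.diagonal v)⁻¹ * B) i j = (v i)⁻¹ * B i j := by
  have h : (Matrix.diagonal v)⁻¹ = Matrix.diagonal fun i => (v i)⁻¹ := by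
    apply Matrix.inv_eq_right_inv
    rw [Matrix.diagonal_mul_diagonal, ← Matrix.diagonal_one]
    congr 1
    funext i
    exact mul_inv_cancel₀ (hv i)
  rw [h, Matrix.diagonal_mul]

theorem mul_diagonal_inv_apply {v : Fin n → ℝ} (hv : ∀ i, v i ≠ 0) (B : Matrix (Fin m) (Fin n) ℝ)
    (i : Fin m) (j : Fin n) : (B * (Matrix.diagonal v)⁻¹) i j = B i j * (v j)⁻¹ := by
  have h : (Matrix.diagonal v)⁻¹ = Matrix.diagonal fun i => (v i)⁻¹ := by
    apply Matrix.inv_eq_right_inv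
    rw [Matrix.diagonal_mul_diagonal, ← Matrix.diagonal_one]
    congr 1
    funext i
    exact mul_inv_cancel₀ (hv i)
  rw [h, Matrix.mul_diagonal]

theorem exp_mem_rowNormalised {B : Matrix (Fin m) (Fin n) ℝ} (hB : B ∈ rowNormalised m n)
    (V : Matrix (Fin m) (Fin n) ℝ) :
    (∀ i, 0 < ∑ j, Real.exp (V i j)) ∧
    (V - Matrix.of fun i _ => Real.log (∑ j, Real.exp (V i j))).map Real.exp =
      (Matrix.diagonal (V.map Real.exp *ᵥ 1))⁻¹ * V.map Real.exp ∧
    (Matrix.diagonal (V.map Real.exp *ᵥ 1))⁻¹ * V.map Real.exp ∈ rowNormalised m n := by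
  rw [mem_rowNormalised] at hB
  have hpos : ∀ i, 0 < ∑ j, Real.exp (V i j) := by
    intro i
    have : Nonempty (Fin n) := by
      by_contra h
      rw [not_nonempty_iff] at h
      simpa using hB i
    exact sum_exp_pos _
  have hv : V.map Real.exp *ᵥ 1 = fun i => ∑ j, Real.exp (V i j) := by
    funext i
    simp [Matrix.mulVec, dotProduct]
  rw [hv]
  refine ⟨hpos, ?_, ?_⟩
  · ext i j
    simp only [Matrix.map_apply, Matrix.sub_apply, Matrix.of_apply, Real.exp_sub,
      Real.exp_log (hpos i), diagonal_inv_mul_apply (fun i => (hpos i).ne')]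
    rw [div_eq_inv_mul]
  · rw [mem_rowNormalised]
    intro i
    simp only [diagonal_inv_mul_apply (fun i => (hpos i).ne'), ← Finset.mul_sum, Matrix.map_apply]
    exact inv_mul_cancel₀ (hpos i).ne'

theorem exp_mem_colNormalised {B : Matrix (Fin m) (Fin n) ℝ} (hB : B ∈ colNormalised m n)
    (V : Matrix (Fin m) (Fin n) ℝ) :
    (∀ j, 0 < ∑ i, Real.exp (V i j)) ∧
    (V - Matrix.of fun _ j => Real.log (∑ i, Real.exp (V i j))).map Real.exp =
      V.map Real.exp * (Matrix.diagonal ((V.map Real.exp)ᵀ *ᵥ 1))⁻¹ ∧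
    V.map Real.exp * (Matrix.diagonal ((V.map Real.exp)ᵀ *ᵥ 1))⁻¹ ∈ colNormalised m n := by
  rw [mem_colNormalised] at hB
  have hpos : ∀ j, 0 < ∑ i, Real.exp (V i j) := by
    intro j
    have : Nonempty (Fin m) := by
      by_contra h
      rw [not_nonempty_iff] at h
      simpa using hB j
    exact sum_exp_pos _
  have hv : (V.map Real.exp)ᵀ *ᵥ 1 = fun j => ∑ i, Real.exp (V i j) := by
    funext i
    simp [Matrix.mulVec, dotProduct]
  rw [hv]
  refine ⟨hpos, ?_, ?_⟩
  · ext i j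
    simp only [Matrix.map_apply, Matrix.sub_apply, Matrix.of_apply, Real.exp_sub,
      Real.exp_log (hpos j), mul_diagonal_inv_apply (fun i => (hpos i).ne')]
    rw [div_eq_mul_inv]
  · rw [mem_colNormalised]
    intro j
    simp only [mul_diagonal_inv_apply (fun i => (hpos i).ne'), ← Finset.sum_mul, Matrix.map_apply]
    exact mul_inv_cancel₀ (hpos j).ne'

/-- For each standard constraint there is a smooth normaliser, constant on the constraint set. -/
theorem IsNormalisation.exists_normaliser (hC : IsNormalisation C) (hne : C.Nonempty) :
    ∃ (N : Matrix (Fin m) (Fin n) ℝ → Matrix (Fin m) (Fin n) ℝ)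
      (ν : Matrix (Fin m) (Fin n) ℝ → ℝ),
      (∀ V, (∀ B ∈ C, matInner B (N V) = ν V) ∧ (V - N V).map Real.exp ∈ C) ∧
      -- Smoothness is expressed entrywise along a smooth family `W`, so no norm on matrices is
      -- involved.
      ∀ (E : Type) [NormedAddCommGroup E] [NormedSpace ℝ E] (W : E → Matrix (Fin m) (Fin n) ℝ),
        (∀ i j, ContDiff ℝ ∞ fun x => W x i j) →
        ContDiff ℝ ∞ (fun x => ν (W x)) ∧ ∀ i j, ContDiff ℝ ∞ fun x => N (W x) i j := by
  obtain ⟨B₀, hB₀⟩ := hne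
  rcases hC with rfl | rfl | rfl | rfl
  · refine ⟨fun _ => 0, fun _ => 0, fun V => ⟨fun B _ => by simp [matInner], Set.mem_univ _⟩, ?_⟩
    intro E _ _ W _
    exact ⟨contDiff_const, fun i j => contDiff_const⟩
  · have hlog : ∀ (E : Type) [NormedAddCommGroup E] [NormedSpace ℝ E]
        (W : E → Matrix (Fin m) (Fin n) ℝ), (∀ i j, ContDiff ℝ ∞ fun x => W x i j) →
        ContDiff ℝ ∞ fun x => Real.log (∑ i, ∑ j, Real.exp (W x i j)) := fun E _ _ W hW =>
      ContDiff.log (ContDiff.sum fun i _ => ContDiff.sum fun j _ => (hW i j).exp)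
        fun x => (exp_mem_totalNormalised hB₀ (W x)).1.ne'
    refine ⟨fun V => Matrix.of fun _ _ => Real.log (∑ i, ∑ j, Real.exp (V i j)),
      fun V => Real.log (∑ i, ∑ j, Real.exp (V i j)), fun V => ⟨fun B hB => ?_, ?_⟩,
      fun E _ _ W hW => ⟨hlog E W hW, fun i j => hlog E W hW⟩⟩
    · simp only [totalNormalised, matInner, Set.mem_ofPred_eq, Matrix.of_apply, mul_one] at hB
      simp only [matInner, Matrix.of_apply, ← Finset.sum_mul, hB, one_mul]
    · rw [(exp_mem_totalNormalised hB₀ V).2.1]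
      exact (exp_mem_totalNormalised hB₀ V).2.2
  · have hlog : ∀ (E : Type) [NormedAddCommGroup E] [NormedSpace ℝ E]
        (W : E → Matrix (Fin m) (Fin n) ℝ), (∀ i j, ContDiff ℝ ∞ fun x => W x i j) → ∀ i,
        ContDiff ℝ ∞ fun x => Real.log (∑ j, Real.exp (W x i j)) := fun E _ _ W hW i =>
      ContDiff.log (ContDiff.sum fun j _ => (hW i j).exp)
        fun x => ((exp_mem_rowNormalised hB₀ (W x)).1 i).ne'
    refine ⟨fun V => Matrix.of fun i _ => Real.log (∑ j, Real.exp (V i j)),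
      fun V => ∑ i, Real.log (∑ j, Real.exp (V i j)), fun V => ⟨fun B hB => ?_, ?_⟩,
      fun E _ _ W hW => ⟨ContDiff.sum fun i _ => hlog E W hW i, fun i j => hlog E W hW i⟩⟩
    · rw [mem_rowNormalised] at hB
      simp only [matInner, Matrix.of_apply, ← Finset.sum_mul, hB, one_mul]
    · rw [(exp_mem_rowNormalised hB₀ V).2.1]
      exact (exp_mem_rowNormalised hB₀ V).2.2
  · have hlog : ∀ (E : Type) [NormedAddCommGroup E] [NormedSpace ℝ E]
        (W : E → Matrix (Fin m) (Fin n) ℝ), (∀ i j, ContDiff ℝ ∞ fun x => W x i j) → ∀ j,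
        ContDiff ℝ ∞ fun x => Real.log (∑ i, Real.exp (W x i j)) := fun E _ _ W hW j =>
      ContDiff.log (ContDiff.sum fun i _ => (hW i j).exp)
        fun x => ((exp_mem_colNormalised hB₀ (W x)).1 j).ne'
    refine ⟨fun V => Matrix.of fun _ j => Real.log (∑ i, Real.exp (V i j)),
      fun V => ∑ j, Real.log (∑ i, Real.exp (V i j)), fun V => ⟨fun B hB => ?_, ?_⟩,
      fun E _ _ W hW => ⟨ContDiff.sum fun j _ => hlog E W hW j, fun i j => hlog E W hW j⟩⟩
    · rw [mem_colNormalised] at hB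
      simp only [matInner, Matrix.of_apply]
      rw [Finset.sum_comm]
      simp only [← Finset.sum_mul, hB, one_mul]
    · rw [(exp_mem_colNormalised hB₀ V).2.1]
      exact (exp_mem_colNormalised hB₀ V).2.2

theorem exists_contDiff_legendre_entropyOn (hC : IsNormalisation C) (hne : C.Nonempty) {E : Type}
    [NormedAddCommGroup E] [NormedSpace ℝ E] {W : E → Matrix (Fin m) (Fin n) ℝ}
    (hW : ∀ i j, ContDiff ℝ ∞ fun x => W x i j) :
    ∃ F : E → ℝ, ContDiff ℝ ∞ F ∧ ∀ x, legendre matInner (entropyOn C) (W x) = (F x : EReal) := by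
  obtain ⟨N, ν, hN, hs⟩ := hC.exists_normaliser hne
  obtain ⟨hν, hNs⟩ := hs E W hW
  exact ⟨_, hν.add (ContDiff.sum fun i _ => ContDiff.sum fun j _ => ((hW i j).sub (hNs i j)).exp),
    fun x => legendre_entropyOn_of_normalised (hN (W x)).1 (hN (W x)).2⟩

end Entropy

/-! ### Subgradients and first-order conditions -/

/-- The endpoint `1` is excluded because a segment may leave the positive matrices there, and the
loss may become infinite. -/
theorem nonneg_of_hasDerivWithinAt_of_forall_le {h : ℝ → ℝ} {h' : ℝ}
    (hd : HasDerivWithinAt h h' (Set.Ico 0 1) 0) (hmin : ∀ t ∈ Set.Ico (0 : ℝ) 1, h 0 ≤ h t) :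
    0 ≤ h' := by
  rw [hasDerivWithinAt_iff_tendsto_slope, Set.Ico_sdiff_left] at hd
  have : (nhdsWithin (0 : ℝ) (Set.Ioo 0 1)).NeBot := left_nhdsWithin_Ioo_neBot one_pos
  refine ge_of_tendsto hd ?_
  filter_upwards [self_mem_nhdsWithin] with t ht
  rw [slope_def_field]
  exact div_nonneg (sub_nonneg.2 (hmin t ⟨ht.1.le, ht.2⟩)) (by linarith [ht.1])

section Subgradient

variable {E : Type*} [NormedAddCommGroup E] [NormedSpace ℝ E] {φ : E → EReal}

/-- Differentiability relative to the effective domain suffices, since the segment stays inside it.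
-/
theorem hasDerivWithinAt_toReal_segment {y₀ v : E} {g : E →L[ℝ] ℝ}
    (hg : HasFDerivWithinAt (fun y => (φ y).toReal) g {y | φ y ≠ ⊤} y₀)
    (hv : ∀ t ∈ Set.Ico (0 : ℝ) 1, φ (y₀ + t • v) ≠ ⊤) :
    HasDerivWithinAt (fun t : ℝ => (φ (y₀ + t • v)).toReal) (g v) (Set.Ico 0 1) 0 := by
  have h1 : HasDerivWithinAt (fun t : ℝ => y₀ + t • v) v (Set.Ico 0 1) 0 := by
    have h2 := ((hasDerivAt_id (0 : ℝ)).smul_const v).const_add y₀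
    simp only [one_smul, id] at h2
    exact h2.hasDerivWithinAt
  have h0 : y₀ = y₀ + (0 : ℝ) • v := by simp
  rw [h0] at hg
  have h3 := HasFDerivWithinAt.comp_hasDerivWithinAt (f := fun t : ℝ => y₀ + t • v) (0 : ℝ) hg
    (by simpa using h1) (fun t ht => by simpa using hv t ht)
  exact h3

/-- The subgradient inequality. On the segment from `y₀` to `y`, the chord minus `φ` is nonnegative
and vanishes at `t = 0`, so its right derivative there is nonnegative. -/
theorem le_of_hasFDerivWithinAt_toReal (hbot : ∀ y, φ y ≠ ⊥) (hconv : EConvex φ) {y₀ : E}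
    (hfin : φ y₀ ≠ ⊤) {g : E →L[ℝ] ℝ}
    (hg : HasFDerivWithinAt (fun y => (φ y).toReal) g {y | φ y ≠ ⊤} y₀) (y : E) :
    (((φ y₀).toReal + g (y - y₀) : ℝ) : EReal) ≤ φ y := by
  by_cases hy : φ y = ⊤
  · rw [hy]
    exact le_top
  obtain ⟨p, hp⟩ : ∃ p : ℝ, φ y₀ = p := ⟨_, (EReal.coe_toReal hfin (hbot _)).symm⟩
  obtain ⟨c, hc⟩ : ∃ c : ℝ, φ y = c := ⟨_, (EReal.coe_toReal hy (hbot _)).symm⟩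
  have hseg : ∀ t ∈ Set.Ico (0 : ℝ) 1,
      φ (y₀ + t • (y - y₀)) ≤ (((1 - t) * p + t * c : ℝ) : EReal) := by
    intro t ht
    have h := hconv y₀ y (1 - t) t (by linarith [ht.2]) ht.1 (by ring)
    rw [hp, hc] at h
    have he : (1 - t) • y₀ + t • y = y₀ + t • (y - y₀) := by
      rw [sub_smul, one_smul, smul_sub]
      abel
    rw [he] at h
    exact_mod_cast h
  have hne : ∀ t ∈ Set.Ico (0 : ℝ) 1, φ (y₀ + t • (y - y₀)) ≠ ⊤ := fun t ht =>
    ne_top_of_le_ne_top (EReal.coe_ne_top _) (hseg t ht)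
  have hd := hasDerivWithinAt_toReal_segment hg hne
  have hd2 : HasDerivWithinAt (fun t : ℝ => (1 - t) * p + t * c) (-p + c) (Set.Ico 0 1) 0 := by
    have h2 := (((hasDerivAt_id (0 : ℝ)).const_sub 1).mul_const p).add
      ((hasDerivAt_id (0 : ℝ)).mul_const c)
    simp only [id] at h2
    exact (h2.congr_deriv (by ring)).hasDerivWithinAt
  have h := nonneg_of_hasDerivWithinAt_of_forall_le (hd2.sub hd) (fun t ht => by
    have h1 := hseg t ht
    rw [← EReal.coe_toReal (hne t ht) (hbot _)] at h1
    have h2 := EReal.coe_le_coe_iff.1 h1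
    simp only [Pi.sub_apply, zero_smul, add_zero, hp, EReal.toReal_coe]
    linarith)
  rw [hp, hc, EReal.toReal_coe]
  exact EReal.coe_le_coe_iff.2 (by linarith)

end Subgradient

/-! ### Entropic regularisation: existence, positivity and optimality of minimisers -/

section Regularised

variable {m n : ℕ} {C : Set (Matrix (Fin m) (Fin n) ℝ)} {ρ : ℝ}
  {ψ : Matrix (Fin m) (Fin n) ℝ → EReal}

theorem continuous_entropyVal : Continuous (entropyVal : Matrix (Fin m) (Fin n) ℝ → ℝ) := by
  unfold entropyVal
  refine continuous_finsetSum _ fun i _ => continuous_finsetSum _ fun j _ => ?_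
  have h : Continuous fun B : Matrix (Fin m) (Fin n) ℝ => B i j := continuous_apply_apply i j
  simp only [mul_sub, mul_one]
  exact (Real.continuous_mul_log.comp h).sub h

theorem add_mul_entropyOn_of_mem {B : Matrix (Fin m) (Fin n) ℝ} (hB : B ∈ C)
    (h0 : ∀ i j, 0 ≤ B i j) :
    ψ B + (ρ : EReal) * entropyOn C B = ψ B + ((ρ * entropyVal B : ℝ) : EReal) := by
  rw [entropyOn_of_mem hB h0, EReal.coe_mul]

theorem add_mul_entropyOn_eq_top (hρ : 0 < ρ) (hbot : ∀ B, ψ B ≠ ⊥) {B : Matrix (Fin m) (Fin n) ℝ}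
    (hB : ¬ (B ∈ C ∧ ∀ i j, 0 ≤ B i j)) : ψ B + (ρ : EReal) * entropyOn C B = ⊤ := by
  rw [entropyOn_eq_top hB, EReal.coe_mul_top_of_pos hρ, EReal.add_top_of_ne_bot (hbot B)]

/-- The entropy is superlinear and `ψ` has an affine minorant, so nonnegative points doing at least
as well as `B₀` lie in a compact box. Lower semicontinuity then gives a minimiser. -/
theorem exists_isMinOn_add_entropyOn (hρ : 0 < ρ) (hbot : ∀ B, ψ B ≠ ⊥)
    (hlsc : LowerSemicontinuous ψ) (hC : IsClosed C) {B₀ : Matrix (Fin m) (Fin n) ℝ} (hB₀ : B₀ ∈ C)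
    (h₀ : ∀ i j, 0 ≤ B₀ i j) (hfin : ψ B₀ ≠ ⊤) {G : Matrix (Fin m) (Fin n) ℝ} {c : ℝ}
    (hG : ∀ B, ((c + matInner B G : ℝ) : EReal) ≤ ψ B) :
    ∃ B ∈ C, (∀ i j, 0 ≤ B i j) ∧ ψ B ≠ ⊤ ∧
      IsMinOn (fun B => ψ B + (ρ : EReal) * entropyOn C B) Set.univ B := by
  obtain ⟨q, hq⟩ : ∃ q : ℝ, ψ B₀ = q := ⟨_, (EReal.coe_toReal hfin (hbot _)).symm⟩
  set J : Matrix (Fin m) (Fin n) ℝ := Matrix.of fun _ _ => 1 with hJ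
  -- Young's inequality is applied at `(J - G)/ρ`: the part `-G/ρ` absorbs the minorant and `J/ρ`
  -- leaves the sum of the entries as a coercive term.
  set K : ℝ := ∑ i, ∑ j, Real.exp (((1 / ρ) • J + (-1 / ρ) • G) i j) with hK
  have hcoer : ∀ B : Matrix (Fin m) (Fin n) ℝ, (∀ i j, 0 ≤ B i j) →
      matInner B J - ρ * K ≤ matInner B G + ρ * entropyVal B := by
    intro B hB
    have h := matInner_sub_entropyVal_le hB ((1 / ρ) • J + (-1 / ρ) • G)
    rw [matInner_add_smul_right, ← hK] at h
    have h2 := mul_le_mul_of_nonneg_left h hρ.le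
    have h3 : ρ * (1 / ρ * matInner B J + -1 / ρ * matInner B G - entropyVal B) =
        matInner B J - matInner B G - ρ * entropyVal B := by
      field_simp
      ring
    linarith
  set M : ℝ := q + ρ * entropyVal B₀ - c + ρ * K with hM
  have hentry : ∀ B : Matrix (Fin m) (Fin n) ℝ, (∀ i j, 0 ≤ B i j) → ∀ i j,
      B i j ≤ matInner B J := by
    intro B hB i j
    simp only [matInner, hJ, Matrix.of_apply, mul_one]
    exact (Finset.single_le_sum (fun b _ => hB i b) (Finset.mem_univ j)).trans
      (Finset.single_le_sum (f := fun a => ∑ b, B a b)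
        (fun a _ => Finset.sum_nonneg fun b _ => hB a b) (Finset.mem_univ i))
  have hbound : ∀ B : Matrix (Fin m) (Fin n) ℝ, (∀ i j, 0 ≤ B i j) →
      ψ B + ((ρ * entropyVal B : ℝ) : EReal) ≤ ((q + ρ * entropyVal B₀ : ℝ) : EReal) →
      matInner B J ≤ M := by
    intro B hB hle
    have h1 := (add_le_add_left (hG B) ((ρ * entropyVal B : ℝ) : EReal)).trans hle
    norm_cast at h1
    linarith [hcoer B hB]
  have hcomp : IsCompact (C ∩ {B : Matrix (Fin m) (Fin n) ℝ | ∀ i j, B i j ∈ Set.Icc 0 M}) := by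
    refine IsCompact.inter_left ?_ hC
    have h := isCompact_univ_pi (X := fun _ : Fin m => Fin n → ℝ)
      (s := fun _ => Set.univ.pi fun _ => Set.Icc 0 M)
      fun _ => isCompact_univ_pi fun _ => isCompact_Icc
    have he : {B : Matrix (Fin m) (Fin n) ℝ | ∀ i j, B i j ∈ Set.Icc 0 M} =
        (Set.univ.pi fun _ => Set.univ.pi fun _ => Set.Icc 0 M) :=
      Set.ext fun B => ⟨fun h i _ j _ => h i j, fun h i j => h i trivial j trivial⟩
    rw [he]
    exact h
  have hlsc' : LowerSemicontinuous fun B => ψ B + ((ρ * entropyVal B : ℝ) : EReal) := by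
    refine hlsc.add' ?_ fun B => EReal.continuousAt_add (Or.inr (EReal.coe_ne_bot _))
      (Or.inr (EReal.coe_ne_top _))
    exact (continuous_coe_real_ereal.comp
      (continuous_const.mul continuous_entropyVal)).lowerSemicontinuous
  have hB₀K : B₀ ∈ C ∩ {B : Matrix (Fin m) (Fin n) ℝ | ∀ i j, B i j ∈ Set.Icc 0 M} :=
    ⟨hB₀, fun i j => ⟨h₀ i j, (hentry B₀ h₀ i j).trans (hbound B₀ h₀ (by rw [hq]; rfl))⟩⟩
  obtain ⟨B, hBK, hmin⟩ := (hlsc'.lowerSemicontinuousOn _).exists_isMinOn ⟨B₀, hB₀K⟩ hcomp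
  have hB0 : ∀ i j, 0 ≤ B i j := fun i j => (hBK.2 i j).1
  have hle0 : ψ B + ((ρ * entropyVal B : ℝ) : EReal) ≤ ((q + ρ * entropyVal B₀ : ℝ) : EReal) := by
    refine (hmin hB₀K).trans ?_
    simp only [hq]
    rfl
  refine ⟨B, hBK.1, hB0, ?_, fun B' _ => ?_⟩
  · intro htop
    rw [htop, EReal.top_add_coe, top_le_iff] at hle0
    exact EReal.coe_ne_top _ hle0
  · change ψ B + (ρ : EReal) * entropyOn C B ≤ ψ B' + (ρ : EReal) * entropyOn C B'
    by_cases h : B' ∈ C ∧ ∀ i j, 0 ≤ B' i j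
    · rw [add_mul_entropyOn_of_mem hBK.1 hB0, add_mul_entropyOn_of_mem h.1 h.2]
      -- A feasible `B'` with value at most that of `B₀` lies in the box; any other is already
      -- beaten by `B₀`.
      rcases le_total (ψ B' + ((ρ * entropyVal B' : ℝ) : EReal))
        ((q + ρ * entropyVal B₀ : ℝ) : EReal) with hle | hle
      · exact hmin ⟨h.1, fun i j => ⟨h.2 i j, (hentry B' h.2 i j).trans (hbound B' h.2 hle)⟩⟩
      · exact hle0.trans hle
    · rw [add_mul_entropyOn_eq_top hρ hbot h]
      exact le_top

/-- If `B i j = 0`, moving by `t` towards `B₀` changes the objective by at most `t (D + ρ B₀ i j log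
t)` with `D` fixed. This is negative for small `t`. -/
theorem pos_of_isMinOn_add_entropyOn (hρ : 0 < ρ) (hbot : ∀ B, ψ B ≠ ⊥) (hconv : EConvex ψ)
    (hC : Convex ℝ C) {B B₀ : Matrix (Fin m) (Fin n) ℝ} (hB₀ : B₀ ∈ C) (h₀ : ∀ i j, 0 < B₀ i j)
    (hfin₀ : ψ B₀ ≠ ⊤) (hB : B ∈ C) (h0 : ∀ i j, 0 ≤ B i j) (hfin : ψ B ≠ ⊤)
    (hmin : IsMinOn (fun B => ψ B + (ρ : EReal) * entropyOn C B) Set.univ B) (i : Fin m)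
    (j : Fin n) : 0 < B i j := by
  obtain ⟨q, hq⟩ : ∃ q : ℝ, ψ B₀ = q := ⟨_, (EReal.coe_toReal hfin₀ (hbot _)).symm⟩
  obtain ⟨p, hp⟩ : ∃ p : ℝ, ψ B = p := ⟨_, (EReal.coe_toReal hfin (hbot _)).symm⟩
  refine (h0 i j).lt_of_ne fun hij => ?_
  have key : ∀ t : ℝ, 0 < t → t ≤ 1 →
      0 ≤ (q + ρ * entropyVal B₀ - (p + ρ * entropyVal B)) + ρ * B₀ i j * Real.log t := by
    intro t ht ht1
    have hMC : (1 - t) • B + t • B₀ ∈ C := hC hB hB₀ (by linarith) ht.le (by ring)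
    have hM0 : ∀ a b, 0 ≤ ((1 - t) • B + t • B₀) a b := fun a b => by
      simp only [Matrix.add_apply, Matrix.smul_apply, smul_eq_mul]
      exact add_nonneg (mul_nonneg (by linarith) (h0 a b)) (mul_nonneg ht.le (h₀ a b).le)
    have h1 := hmin (Set.mem_univ ((1 - t) • B + t • B₀))
    simp only [Set.mem_ofPred_eq, add_mul_entropyOn_of_mem hMC hM0,
      add_mul_entropyOn_of_mem hB h0] at h1
    have h2 := hconv B B₀ (1 - t) t (by linarith) ht.le (by ring)
    rw [hp, hq] at h2
    have h3 := h1.trans (add_le_add_left h2 _)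
    rw [hp] at h3
    norm_cast at h3
    have hent : entropyVal ((1 - t) • B + t • B₀) ≤
        (1 - t) * entropyVal B + t * entropyVal B₀ + t * B₀ i j * Real.log t := by
      -- The extra term is spread as a double sum supported at `(i, j)`, so that the entropies
      -- compare entry by entry.
      have hz : t * B₀ i j * Real.log t =
          ∑ a, ∑ b, if a = i ∧ b = j then t * B₀ i j * Real.log t else 0 := by
        rw [Finset.sum_eq_single i, Finset.sum_eq_single j]
        · simp
        · intro b _ hb
          simp [hb]
        · simp
        · intro a _ ha
          simp [ha]
        · simp
      rw [hz]
      simp only [entropyVal, Matrix.add_apply, Matrix.smul_apply, smul_eq_mul, Finset.mul_sum,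
        ← Finset.sum_add_distrib]
      refine Finset.sum_le_sum fun a _ => Finset.sum_le_sum fun b _ => ?_
      split_ifs with hab
      · obtain ⟨rfl, rfl⟩ := hab
        rw [← hij, mul_zero, zero_add, Real.log_mul ht.ne' (h₀ _ _).ne']
        apply le_of_eq
        ring
      · rw [add_zero]
        exact mul_log_sub_one_convex (h0 a b) (h₀ a b).le (by linarith) ht.le (by ring)
    have h4 := mul_le_mul_of_nonneg_left hent hρ.le
    refine nonneg_of_mul_nonneg_right (a := t) ?_ ht
    linarith
  set D := q + ρ * entropyVal B₀ - (p + ρ * entropyVal B) with hD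
  have hc : 0 < ρ * B₀ i j := mul_pos hρ (h₀ i j)
  -- This `t` makes `ρ B₀ i j log t = -(|D| + 1)`.
  have h := key (Real.exp (-((|D| + 1) / (ρ * B₀ i j)))) (Real.exp_pos _)
    (Real.exp_le_one_iff.2 (neg_nonpos.2 (by positivity)))
  rw [Real.log_exp, mul_neg, mul_div_cancel₀ _ hc.ne'] at h
  linarith [le_abs_self D]

theorem hasDerivAt_entropyVal_segment {B V : Matrix (Fin m) (Fin n) ℝ} (hB : ∀ i j, 0 < B i j) :
    HasDerivAt (fun t : ℝ => entropyVal (B + t • V)) (matInner V (B.map Real.log)) 0 := by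
  simp only [entropyVal, matInner, Matrix.add_apply, Matrix.smul_apply, smul_eq_mul,
    Matrix.map_apply]
  refine HasDerivAt.fun_sum fun i _ => HasDerivAt.fun_sum fun j _ => ?_
  have h1 : HasDerivAt (fun t : ℝ => B i j + t * V i j) (V i j) 0 := by
    simpa using ((hasDerivAt_id (0 : ℝ)).mul_const (V i j)).const_add (B i j)
  have hne : B i j + 0 * V i j ≠ 0 := by simpa using (hB i j).ne'
  have h2 := h1.mul ((h1.log hne).sub_const 1)
  refine h2.congr_deriv ?_
  rw [mul_div_cancel₀ _ hne]
  simp only [zero_mul, add_zero]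
  ring

/-- The gradient inequality for the entropy, which is Young's inequality at `v = log (B i j)`. -/
theorem entropyVal_add_le {B B' : Matrix (Fin m) (Fin n) ℝ} (hB : ∀ i j, 0 < B i j)
    (hB' : ∀ i j, 0 ≤ B' i j) :
    entropyVal B + matInner (B' - B) (B.map Real.log) ≤ entropyVal B' := by
  simp only [entropyVal, matInner, Matrix.sub_apply, Matrix.map_apply, ← Finset.sum_add_distrib]
  refine Finset.sum_le_sum fun i _ => Finset.sum_le_sum fun j _ => ?_
  have h := mul_sub_mul_log_le_exp (hB' i j) (Real.log (B i j))
  rw [Real.exp_log (hB i j)] at h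
  linarith

/-- First-order optimality of a positive minimiser of an entropically regularised problem. -/
theorem le_of_isMinOn_add_entropyOn {E : Type*} [NormedAddCommGroup E] [NormedSpace ℝ E]
    {φ : E → EReal} (hbot : ∀ y, φ y ≠ ⊥) (L : Matrix (Fin m) (Fin n) ℝ →ₗ[ℝ] E) (hρ : 0 < ρ)
    (hC : Convex ℝ C) (hfin : ∀ B ∈ C, (∀ i j, 0 < B i j) → φ (L B) ≠ ⊤)
    {B : Matrix (Fin m) (Fin n) ℝ} (hB : B ∈ C) (h0 : ∀ i j, 0 < B i j)
    (hmin : IsMinOn (fun B => φ (L B) + (ρ : EReal) * entropyOn C B) Set.univ B) {g : E →L[ℝ] ℝ}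
    (hg : HasFDerivWithinAt (fun y => (φ y).toReal) g {y | φ y ≠ ⊤} (L B))
    {B' : Matrix (Fin m) (Fin n) ℝ} (hB' : B' ∈ C) (h0' : ∀ i j, 0 ≤ B' i j) :
    ρ * entropyVal B + g (L B) ≤ ρ * entropyVal B' + g (L B') := by
  -- For `t < 1` the segment stays entrywise positive even where `B'` vanishes, so the loss is
  -- finite along it.
  have hmem : ∀ t ∈ Set.Ico (0 : ℝ) 1, B + t • (B' - B) ∈ C ∧ ∀ i j, 0 < (B + t • (B' - B)) i j := by
    intro t ht
    have he : B + t • (B' - B) = (1 - t) • B + t • B' := by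
      rw [sub_smul, one_smul, smul_sub]
      abel
    rw [he]
    refine ⟨hC hB hB' (by linarith [ht.2]) ht.1 (by ring), fun i j => ?_⟩
    simp only [Matrix.add_apply, Matrix.smul_apply, smul_eq_mul]
    exact add_pos_of_pos_of_nonneg (mul_pos (by linarith [ht.2]) (h0 i j))
      (mul_nonneg ht.1 (h0' i j))
  have hL : ∀ t : ℝ, L B + t • (L B' - L B) = L (B + t • (B' - B)) := fun t => by simp
  have hfin' : ∀ t ∈ Set.Ico (0 : ℝ) 1, φ (L B + t • (L B' - L B)) ≠ ⊤ := fun t ht => by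
    rw [hL]
    exact hfin _ (hmem t ht).1 (hmem t ht).2
  have hd := (hasDerivWithinAt_toReal_segment hg hfin').add
    (((hasDerivAt_entropyVal_segment (V := B' - B) h0).hasDerivWithinAt (s := Set.Ico 0 1)).const_mul
      ρ)
  have h := nonneg_of_hasDerivWithinAt_of_forall_le hd (fun t ht => by
    have h1 := hmin (Set.mem_univ (B + t • (B' - B)))
    simp only [Set.mem_ofPred_eq] at h1
    rw [entropyOn_of_mem hB fun i j => (h0 i j).le,
      entropyOn_of_mem (hmem t ht).1 fun i j => ((hmem t ht).2 i j).le,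
      ← EReal.coe_toReal (hfin _ (hmem t ht).1 (hmem t ht).2) (hbot _),
      ← EReal.coe_toReal (hfin _ hB h0) (hbot _)] at h1
    norm_cast at h1
    simpa only [Pi.add_apply, hL, zero_smul, add_zero] using h1)
  -- Convexity replaces the directional derivative of the entropy by the difference of its values.
  have h2 := mul_le_mul_of_nonneg_left (entropyVal_add_le h0 h0') hρ.le
  rw [map_sub] at h
  linarith

end Regularised

/-! ### Duality -/

section Duality

variable {d : ℕ} {p : Fin d → ℕ} {m n : ℕ} {C : Set (Matrix (Fin m) (Fin n) ℝ)} {ρ : ℝ}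
  {φ : Tensor p → EReal} {L : Matrix (Fin m) (Fin n) ℝ →ₗ[ℝ] Tensor p}
  {Ξ : Tensor p → Matrix (Fin m) (Fin n) ℝ}

theorem tensorInner_sub_left (T T' U : Tensor p) :
    tensorInner (T - T') U = tensorInner T U - tensorInner T' U := by
  simp [tensorInner, sub_mul]

theorem exists_tensorInner_eq (g : Tensor p →L[ℝ] ℝ) : ∃ U, ∀ T, g T = tensorInner T U := by
  refine ⟨fun i => g (Pi.single i 1), fun T => ?_⟩
  conv_lhs => rw [← Finset.univ_sum_single T]
  rw [map_sum]
  refine Finset.sum_congr rfl fun i _ => ?_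
  have h : (Pi.single i (T i) : Tensor p) = T i • Pi.single i 1 := by
    rw [← Pi.single_smul, smul_eq_mul, mul_one]
  rw [h, map_smul, smul_eq_mul]

/-- The dual objective is bounded below by minus a finite primal value; if the two agree, the
primal point solves the recovery problem. -/
theorem neg_le_dual (hρ : 0 < ρ) (hadj : ∀ B U, tensorInner (L B) U = matInner B (Ξ U))
    {B : Matrix (Fin m) (Fin n) ℝ} (hB : B ∈ C) (h0 : ∀ i j, 0 ≤ B i j) {q : ℝ}
    (hq : φ (L B) = q) (U : Tensor p) :
    ((-(q + ρ * entropyVal B) : ℝ) : EReal) ≤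
        legendre tensorInner φ U + (ρ : EReal) * legendre matInner (entropyOn C) ((-1 / ρ) • Ξ U) ∧
      (legendre tensorInner φ U + (ρ : EReal) * legendre matInner (entropyOn C) ((-1 / ρ) • Ξ U) =
          ((-(q + ρ * entropyVal B) : ℝ) : EReal) →
        IsMaxOn (fun B => ((matInner B ((-1 / ρ) • Ξ U) : ℝ) : EReal) - entropyOn C B)
          Set.univ B) := by
  have h1 := le_legendre (pair := tensorInner) (f := φ) (L B) U
  have h2 := le_legendre (pair := matInner) (f := entropyOn C) B ((-1 / ρ) • Ξ U)
  rw [hq, ← EReal.coe_sub, hadj] at h1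
  rw [entropyOn_of_mem hB h0, ← EReal.coe_sub] at h2
  have hsum : matInner B (Ξ U) - q + ρ * (matInner B ((-1 / ρ) • Ξ U) - entropyVal B) =
      -(q + ρ * entropyVal B) := by
    rw [matInner_smul_right]
    field_simp
    ring
  have hρ' : (0 : EReal) ≤ ρ := EReal.coe_nonneg.2 hρ.le
  constructor
  · rw [← hsum, EReal.coe_add, EReal.coe_mul]
    exact add_le_add h1 (mul_le_mul_of_nonneg_left h2 hρ')
  · intro heq B' _
    refine (le_legendre (pair := matInner) (f := entropyOn C) B' ((-1 / ρ) • Ξ U)).trans ?_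
    simp only [entropyOn_of_mem hB h0]
    rw [← EReal.coe_sub]
    -- The two Young bounds add up to the given value, so both are tight. The conjugates must be
    -- shown finite before cancelling.
    generalize legendre matInner (entropyOn C) ((-1 / ρ) • Ξ U) = b at *
    generalize legendre tensorInner φ U = a at *
    have ha : a ≠ ⊥ := fun h => by
      rw [h, le_bot_iff] at h1
      exact EReal.coe_ne_bot _ h1
    induction b with
    | bot => exact bot_le
    | top =>
      rw [EReal.coe_mul_top_of_pos hρ, EReal.add_top_of_ne_bot ha] at heq
      exact absurd heq.symm (EReal.coe_ne_top _)
    | coe b =>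
      rw [← EReal.coe_mul] at heq
      induction a with
      | bot => exact absurd rfl ha
      | top =>
        rw [EReal.top_add_coe] at heq
        exact absurd heq.symm (EReal.coe_ne_top _)
      | coe a =>
        rw [← EReal.coe_add, EReal.coe_eq_coe_iff] at heq
        rw [EReal.coe_le_coe_iff] at h1 ⊢
        have : ρ * b ≤ ρ * (matInner B ((-1 / ρ) • Ξ U) - entropyVal B) := by linarith
        exact le_of_mul_le_mul_left this hρ

/-- Attainment and strong duality for an entropically regularised problem. -/
theorem exists_primal_dual (hρ : 0 < ρ) (hadj : ∀ B U, tensorInner (L B) U = matInner B (Ξ U))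
    (hbot : ∀ y, φ y ≠ ⊥) (hconv : EConvex φ) (hlsc : LowerSemicontinuous φ) (hC : Convex ℝ C)
    (hCc : IsClosed C) (hfeas : ∃ B ∈ C, ∀ a b, 0 < B a b)
    (hdiff : ∀ B ∈ C, (∀ a b, 0 < B a b) → φ (L B) ≠ ⊤ ∧
      DifferentiableWithinAt ℝ (fun Y => (φ Y).toReal) {Y | φ Y ≠ ⊤} (L B)) :
    ∃ B ∈ C, (∀ i j, 0 ≤ B i j) ∧ ∃ q : ℝ, φ (L B) = q ∧
      IsMinOn (fun B => φ (L B) + (ρ : EReal) * entropyOn C B) Set.univ B ∧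
      ∃ U, legendre tensorInner φ U +
        (ρ : EReal) * legendre matInner (entropyOn C) ((-1 / ρ) • Ξ U) =
          ((-(q + ρ * entropyVal B) : ℝ) : EReal) := by
  obtain ⟨B₀, hB₀, h₀⟩ := hfeas
  obtain ⟨hfin₀, g₀, hg₀⟩ := hdiff B₀ hB₀ h₀
  have hLc : Continuous L := L.continuous_of_finiteDimensional
  have hψconv : EConvex fun B => φ (L B) := hconv.comp_isLinearMap L.isLinear
  have hψlsc : LowerSemicontinuous fun B => φ (L B) := hlsc.comp hLc
  obtain ⟨U₀, hU₀⟩ := exists_tensorInner_eq g₀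
  have hminor : ∀ B, ((((φ (L B₀)).toReal - g₀ (L B₀)) + matInner B (Ξ U₀) : ℝ) : EReal) ≤
      φ (L B) := by
    intro B
    refine le_trans (EReal.coe_le_coe_iff.2 ?_)
      (le_of_hasFDerivWithinAt_toReal hbot hconv hfin₀ hg₀ (L B))
    rw [map_sub, hU₀ (L B), hadj]
    linarith
  obtain ⟨B, hB, h0, hfin, hmin⟩ := exists_isMinOn_add_entropyOn (ψ := fun B => φ (L B)) hρ
    (fun B => hbot _) hψlsc hCc hB₀ (fun i j => (h₀ i j).le) hfin₀ hminor
  have hpos := pos_of_isMinOn_add_entropyOn (ψ := fun B => φ (L B)) hρ (fun B => hbot _) hψconv hC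
    hB₀ h₀ hfin₀ hB h0 hfin hmin
  -- Positivity of the minimiser is what makes the loss differentiable at it; the gradient is the
  -- dual certificate.
  obtain ⟨-, g, hg⟩ := hdiff B hB hpos
  obtain ⟨q, hq⟩ : ∃ q : ℝ, φ (L B) = q := ⟨_, (EReal.coe_toReal hfin (hbot _)).symm⟩
  obtain ⟨U, hU⟩ := exists_tensorInner_eq g
  refine ⟨B, hB, h0, q, hq, hmin, U, le_antisymm ?_ (neg_le_dual hρ hadj hB h0 hq U).1⟩
  -- Tightness for the loss is the subgradient inequality at `L B`; tightness for the entropy (`h2`)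
  -- is first-order optimality of `B`.
  have h1 : legendre tensorInner φ U ≤ ((tensorInner (L B) U - q : ℝ) : EReal) := by
    refine iSup_le fun Y => ?_
    have h := le_of_hasFDerivWithinAt_toReal hbot hconv hfin hg Y
    rw [hq, hU, EReal.toReal_coe, tensorInner_sub_left] at h
    refine (EReal.sub_le_sub le_rfl h).trans ?_
    norm_cast
    linarith
  have h2 : legendre matInner (entropyOn C) ((-1 / ρ) • Ξ U) ≤
      ((matInner B ((-1 / ρ) • Ξ U) - entropyVal B : ℝ) : EReal) := by
    refine iSup_le fun B' => ?_
    by_cases h : B' ∈ C ∧ ∀ i j, 0 ≤ B' i j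
    · rw [entropyOn_of_mem h.1 h.2, ← EReal.coe_sub, EReal.coe_le_coe_iff]
      have hopt := le_of_isMinOn_add_entropyOn hbot L hρ hC (fun B hB h0 => (hdiff B hB h0).1) hB
        hpos hmin hg h.1 h.2
      rw [hU, hU, hadj, hadj] at hopt
      rw [matInner_smul_right, matInner_smul_right]
      refine le_of_mul_le_mul_left (a := ρ) ?_ hρ
      have e : ∀ x y : ℝ, ρ * (-1 / ρ * x - y) = -(ρ * y + x) := fun x y => by
        field_simp
        ring
      rw [e, e]
      linarith
    · rw [entropyOn_eq_top h]
      simp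
  refine (add_le_add h1 (mul_le_mul_of_nonneg_left h2 (EReal.coe_nonneg.2 hρ.le))).trans ?_
  rw [← EReal.coe_mul, ← EReal.coe_add, EReal.coe_le_coe_iff, matInner_smul_right, hadj]
  apply le_of_eq
  field_simp
  ring

end Duality

/-! ### Conjugates of optimal transport losses -/

theorem coe_finset_sum_ereal {κ : Type*} (s : Finset κ) (f : κ → ℝ) :
    ((∑ a ∈ s, f a : ℝ) : EReal) = ∑ a ∈ s, (f a : EReal) :=
  map_sum (⟨⟨Real.toEReal, EReal.coe_zero⟩, EReal.coe_add⟩ : ℝ →+ EReal) f s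

section Transport

variable {ι : Type*} [Fintype ι]

/-- The Gibbs variational principle at fixed total mass `a`. -/
theorem sum_mul_sub_mul_log_le {g v : ι → ℝ} (hg : ∀ j, 0 ≤ g j) :
    ∑ j, (g j * v j - g j * (Real.log (g j) - 1)) ≤
      (∑ j, g j) * (1 - Real.log (∑ j, g j) + Real.log (∑ j, Real.exp (v j))) := by
  set a := ∑ j, g j with ha
  rcases (Finset.sum_nonneg fun j _ => hg j : 0 ≤ ∑ j, g j).eq_or_lt with h0 | hpos
  · have h := (Finset.sum_eq_zero_iff_of_nonneg fun j _ => hg j).1 h0.symm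
    rw [ha, ← h0, Finset.sum_eq_zero fun j hj => by rw [h j hj]; simp]
    simp
  · rw [← ha] at hpos
    have : Nonempty ι := by
      by_contra h
      rw [not_nonempty_iff] at h
      simp [ha] at hpos
    have hz := sum_exp_pos v
    set z := ∑ j, Real.exp (v j) with hzdef
    -- Shifting `v` by `log (z / a)` makes the exponentials sum to exactly `a`.
    have h1 : ∑ j, (g j * (v j - (Real.log z - Real.log a)) - g j * (Real.log (g j) - 1)) ≤
        ∑ j, Real.exp (v j - (Real.log z - Real.log a)) :=
      Finset.sum_le_sum fun j _ => mul_sub_mul_log_le_exp (hg j) _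
    have h2 : ∑ j, Real.exp (v j - (Real.log z - Real.log a)) = a := by
      simp only [Real.exp_sub, Real.exp_log hz, Real.exp_log hpos]
      rw [← Finset.sum_div, ← hzdef]
      field_simp
    have h3 : ∑ j, (g j * (v j - (Real.log z - Real.log a)) - g j * (Real.log (g j) - 1)) =
        ∑ j, (g j * v j - g j * (Real.log (g j) - 1)) - a * (Real.log z - Real.log a) := by
      rw [ha, Finset.sum_mul, ← Finset.sum_sub_distrib]
      exact Finset.sum_congr rfl fun j _ => by ring
    linarith

theorem sum_mul_sub_mul_log_eq [Nonempty ι] {a : ℝ} (ha : 0 ≤ a) (v : ι → ℝ) :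
    ∑ j, a * (Real.exp (v j) / ∑ l, Real.exp (v l)) = a ∧
    ∑ j, (a * (Real.exp (v j) / ∑ l, Real.exp (v l)) * v j -
      a * (Real.exp (v j) / ∑ l, Real.exp (v l)) *
        (Real.log (a * (Real.exp (v j) / ∑ l, Real.exp (v l))) - 1)) =
      a * (1 - Real.log a + Real.log (∑ j, Real.exp (v j))) := by
  have hz := sum_exp_pos v
  set z := ∑ j, Real.exp (v j) with hzdef
  have h1 : ∑ j, a * (Real.exp (v j) / z) = a := by
    rw [← Finset.mul_sum, ← Finset.sum_div, ← hzdef, div_self hz.ne', mul_one]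
  refine ⟨h1, ?_⟩
  rcases ha.eq_or_lt with rfl | hpos
  · simp
  · conv_rhs => rw [← h1, Finset.sum_mul]
    refine Finset.sum_congr rfl fun j _ => ?_
    rw [Real.log_mul hpos.ne' (by positivity), Real.log_div (Real.exp_pos _).ne' hz.ne',
      Real.log_exp, h1]
    ring

/-- The conjugate of `KL(q | ·)` at `1 - s`, from `log x ≤ x - 1` at `x = s b / q`. Equality holds
at `b = q / s`, and the application takes `s = 1 - u / λ`. -/
theorem mul_sub_mul_kl_le {q b s : ℝ} (hq : 0 ≤ q) (hb : 0 ≤ b) (hqb : b = 0 → q = 0)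
    (hs : 0 < s) : b * (1 - s) - (q * Real.log (q / b) - q + b) ≤ -(q * Real.log s) := by
  rcases hq.eq_or_lt with rfl | hq
  · have := mul_nonneg hb hs.le
    simp only [zero_mul, sub_zero, zero_add, neg_zero]
    linarith
  · have hb' : 0 < b := hb.lt_of_ne fun h => hq.ne' (hqb h.symm)
    have h := Real.log_le_sub_one_of_pos (show 0 < s * b / q by positivity)
    rw [Real.log_div (by positivity) hq.ne', Real.log_mul hs.ne' hb'.ne'] at h
    rw [Real.log_div hq.ne' hb'.ne']
    have h2 := mul_le_mul_of_nonneg_left h hq.le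
    have h3 : q * (s * b / q - 1) = s * b - q := by field_simp
    linarith

theorem mul_sub_mul_kl_eq {q s : ℝ} (hs : 0 < s) :
    q / s * (1 - s) - (q * Real.log (q / (q / s)) - q + q / s) = -(q * Real.log s) := by
  rcases eq_or_ne q 0 with rfl | hq
  · simp
  · rw [div_div_cancel₀ hq]
    field_simp
    ring

/-- The conjugate of `b ↦ λ KL(q | b)` divided by `q`. -/
def klPotential (lam : ℝ) (u : ι → ℝ) (j : ι) : ℝ := -(lam * Real.log (1 - u j / lam))

/-- The conjugate of `b ↦ OT(a, b)`, on vectors whose entries are smaller than `λ`. -/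
def semiOTConj (ε lam : ℝ) (c : ι → ι → ℝ) (a u : ι → ℝ) : ℝ :=
  ∑ i, ε * (a i * (1 - Real.log (a i) +
    Real.log (∑ j, Real.exp ((klPotential lam u j - c i j) / ε))))

/-- Moves the cost from the kernel into the exponent. The result splits over the rows of `γ`, as
does the marginal constraint. -/
theorem sum_sub_mul_relEntropy_eq {ε : ℝ} (hε : 0 < ε) (c γ : ι → ι → ℝ) (w : ι → ℝ) :
    ∑ j, (∑ i, γ i j) * w j - ε * relEntropy γ (fun i j => Real.exp (-c i j / ε)) =
      ∑ i, ε * ∑ j, (γ i j * ((w j - c i j) / ε) - γ i j * (Real.log (γ i j) - 1)) := by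
  simp only [Finset.sum_mul]
  rw [Finset.sum_comm, relEntropy, Finset.mul_sum, ← Finset.sum_sub_distrib]
  refine Finset.sum_congr rfl fun i _ => ?_
  rw [Finset.mul_sum, Finset.mul_sum, ← Finset.sum_sub_distrib]
  refine Finset.sum_congr rfl fun j _ => ?_
  rcases eq_or_ne (γ i j) 0 with h | h
  · simp [h]
  · rw [Real.log_div h (Real.exp_pos _).ne', Real.log_exp]
    field_simp
    ring

variable {ε lam : ℝ} {c : ι → ι → ℝ} {a : ι → ℝ}

theorem one_sub_div_pos (hlam : 0 < lam) {u : ℝ} (hu : u < lam) : 0 < 1 - u / lam := by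
  rw [sub_pos, div_lt_one hlam]
  exact hu

/-- For each plan, the KL inequality eliminates `b` in favour of `klPotential`, and the Gibbs
principle then bounds each row. -/
theorem le_semiOT (hε : 0 < ε) (hlam : 0 < lam) {b u : ι → ℝ} (hb : ∀ j, 0 ≤ b j)
    (hu : ∀ j, u j < lam) :
    ((∑ j, b j * u j - semiOTConj ε lam c a u : ℝ) : EReal) ≤ semiOT ε lam c a b := by
  refine le_iInf₂ fun γ hγ => ?_
  obtain ⟨hγ0, hγa⟩ := hγ
  by_cases hq : ∀ j, b j = 0 → ∑ i, γ i j = 0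
  · rw [klDiv, if_pos hq, ← EReal.coe_mul, ← EReal.coe_add, EReal.coe_le_coe_iff]
    have h1 := sum_sub_mul_relEntropy_eq hε c γ (klPotential lam u)
    have h2 : ∑ i, ε * ∑ j, (γ i j * ((klPotential lam u j - c i j) / ε) -
        γ i j * (Real.log (γ i j) - 1)) ≤ semiOTConj ε lam c a u := by
      refine Finset.sum_le_sum fun i _ => mul_le_mul_of_nonneg_left ?_ hε.le
      rw [← hγa i]
      exact sum_mul_sub_mul_log_le (hγ0 i)
    have h3 : ∑ j, b j * u j - lam * ((∑ j, (∑ i, γ i j) * Real.log ((∑ i, γ i j) / b j)) -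
        (∑ j, ∑ i, γ i j) + ∑ j, b j) ≤ ∑ j, (∑ i, γ i j) * klPotential lam u j := by
      rw [← Finset.sum_sub_distrib, ← Finset.sum_add_distrib, Finset.mul_sum,
        ← Finset.sum_sub_distrib]
      refine Finset.sum_le_sum fun j _ => ?_
      have h4 := mul_le_mul_of_nonneg_left (mul_sub_mul_kl_le
        (Finset.sum_nonneg fun i _ => hγ0 i j) (hb j) (hq j) (one_sub_div_pos hlam (hu j))) hlam.le
      have h5 : lam * (b j * (1 - (1 - u j / lam))) = b j * u j := by field_simp; ring
      simp only [klPotential]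
      linarith
    linarith
  · rw [klDiv, if_neg hq, EReal.coe_mul_top_of_pos hlam, EReal.coe_add_top]
    exact le_top

theorem exists_semiOT_le (hε : 0 < ε) (hlam : 0 < lam) (ha : ∀ i, 0 ≤ a i) {u : ι → ℝ}
    (hu : ∀ j, u j < lam) :
    ∃ b : ι → ℝ, (∀ j, 0 ≤ b j) ∧
      semiOT ε lam c a b ≤ ((∑ j, b j * u j - semiOTConj ε lam c a u : ℝ) : EReal) := by
  set v : ι → ι → ℝ := fun i j => (klPotential lam u j - c i j) / ε with hv
  set γ : ι → ι → ℝ := fun i j => a i * (Real.exp (v i j) / ∑ l, Real.exp (v i l)) with hγ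
  have hγ0 : ∀ i j, 0 ≤ γ i j := fun i j => mul_nonneg (ha i) (by positivity)
  have hrow : ∀ i, ∑ j, γ i j = a i := fun i =>
    have : Nonempty ι := ⟨i⟩
    (sum_mul_sub_mul_log_eq (ha i) (v i)).1
  have hs : ∀ j, 0 < 1 - u j / lam := fun j => one_sub_div_pos hlam (hu j)
  -- Both inequalities of `le_semiOT` are tight here: the rows of `γ` are softmax weights of mass `a
  -- i`, and `b = q / s` is the KL maximiser for the column sums `q`.
  refine ⟨fun j => (∑ i, γ i j) / (1 - u j / lam),
    fun j => div_nonneg (Finset.sum_nonneg fun i _ => hγ0 i j) (hs j).le, ?_⟩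
  refine (iInf₂_le γ ⟨hγ0, hrow⟩).trans ?_
  have hq : ∀ j, (∑ i, γ i j) / (1 - u j / lam) = 0 → ∑ i, γ i j = 0 := fun j h =>
    (div_eq_zero_iff.1 h).resolve_right (hs j).ne'
  rw [klDiv, if_pos hq, ← EReal.coe_mul, ← EReal.coe_add, EReal.coe_le_coe_iff]
  have h1 := sum_sub_mul_relEntropy_eq hε c γ (klPotential lam u)
  have h2 : ∑ i, ε * ∑ j, (γ i j * ((klPotential lam u j - c i j) / ε) -
      γ i j * (Real.log (γ i j) - 1)) = semiOTConj ε lam c a u := by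
    refine Finset.sum_congr rfl fun i _ => ?_
    have : Nonempty ι := ⟨i⟩
    exact congrArg (ε * ·) (sum_mul_sub_mul_log_eq (ha i) (v i)).2
  have h3 : ∑ j, (∑ i, γ i j) / (1 - u j / lam) * u j -
      lam * ((∑ j, (∑ i, γ i j) * Real.log ((∑ i, γ i j) / ((∑ i, γ i j) / (1 - u j / lam)))) -
        (∑ j, ∑ i, γ i j) + ∑ j, (∑ i, γ i j) / (1 - u j / lam)) =
      ∑ j, (∑ i, γ i j) * klPotential lam u j := by
    rw [← Finset.sum_sub_distrib, ← Finset.sum_add_distrib, Finset.mul_sum,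
      ← Finset.sum_sub_distrib]
    refine Finset.sum_congr rfl fun j _ => ?_
    have h4 := congrArg (lam * ·) (mul_sub_mul_kl_eq (q := ∑ i, γ i j) (hs j))
    have h5 : lam * ((∑ i, γ i j) / (1 - u j / lam) * (1 - (1 - u j / lam))) =
        (∑ i, γ i j) / (1 - u j / lam) * u j := by
      rw [sub_sub_cancel]
      field_simp
    simp only [klPotential]
    linarith
  linarith

/-- The diagonal plan has a cost independent of `τ`, and `KL(a | a + τ) ≤ ∑ τ`. This linear growth
makes the conjugate infinite when some `u i > λ`. -/
theorem exists_forall_semiOT_add_le (hlam : 0 < lam) (ha : ∀ i, 0 ≤ a i) :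
    ∃ M : ℝ, ∀ τ : ι → ℝ, (∀ i, 0 ≤ τ i) →
      semiOT ε lam c a (a + τ) ≤ ((M + lam * ∑ i, τ i : ℝ) : EReal) := by
  classical
  set γ : ι → ι → ℝ := fun i j => if i = j then a i else 0 with hγ
  refine ⟨ε * relEntropy γ (fun i j => Real.exp (-c i j / ε)), fun τ hτ => ?_⟩
  have hγ0 : ∀ i j, 0 ≤ γ i j := fun i j => by
    simp only [hγ]
    split_ifs
    exacts [ha i, le_rfl]
  refine (iInf₂_le γ ⟨hγ0, fun i => by simp [hγ]⟩).trans ?_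
  have hcol : (fun j => ∑ i, γ i j) = a := by
    funext j
    simp [hγ]
  have hq : ∀ j, (a + τ) j = 0 → a j = 0 := fun j h => by
    rw [Pi.add_apply] at h
    linarith [ha j, hτ j]
  rw [hcol, klDiv, if_pos hq, ← EReal.coe_mul, ← EReal.coe_add, EReal.coe_le_coe_iff]
  refine add_le_add le_rfl (mul_le_mul_of_nonneg_left ?_ hlam.le)
  have h1 : ∑ j, a j * Real.log (a j / (a + τ) j) ≤ 0 := by
    refine Finset.sum_nonpos fun j _ => mul_nonpos_of_nonneg_of_nonpos (ha j) ?_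
    have h0 : 0 ≤ (a + τ) j := add_nonneg (ha j) (hτ j)
    exact Real.log_nonpos (div_nonneg (ha j) h0)
      (div_le_one_of_le₀ (by simpa using hτ j) h0)
  simp only [Pi.add_apply, Finset.sum_add_distrib] at h1 ⊢
  linarith

theorem contDiffOn_semiOTConj (hlam : 0 < lam) {E : Type*} [NormedAddCommGroup E]
    [NormedSpace ℝ E] {v : E → ι → ℝ} {s : Set E} (hv : ∀ j, ContDiff ℝ ∞ fun x => v x j)
    (hs : ∀ x ∈ s, ∀ j, v x j < lam) :
    ContDiffOn ℝ ∞ (fun x => semiOTConj ε lam c a (v x)) s := by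
  unfold semiOTConj klPotential
  refine ContDiffOn.sum fun i _ => contDiffOn_const.mul (contDiffOn_const.mul
    (contDiffOn_const.add (ContDiffOn.log ?_ fun x _ => ?_)))
  · refine ContDiffOn.sum fun j _ => ContDiffOn.exp ?_
    refine ((contDiffOn_const.mul (ContDiffOn.log ?_ fun x hx => ?_)).neg.sub
      contDiffOn_const).div_const _
    · exact contDiffOn_const.sub ((hv j).contDiffOn.div_const _)
    · exact (one_sub_div_pos hlam (hs x hx j)).ne'
  · have : Nonempty ι := ⟨i⟩
    exact (sum_exp_pos _).ne'

end Transport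

/-! ### Transport losses on tensors, whole or slice by slice. -/

section TransportLoss

variable {d : ℕ} {n : Fin d → ℕ} {Φ : Tensor n → Tensor n → EReal} {X : Tensor n} {ε lam : ℝ}

theorem sum_matricise (s : Fin d) (T : Tensor n) : ∑ a, ∑ c, matricise s T a c = ∑ i, T i := by
  rw [← Fintype.sum_prod_type' (f := fun a c => matricise s T a c),
    ← (Equiv.piSplitAt s fun j => Fin (n j)).symm.sum_comp]
  refine Finset.sum_congr rfl fun x _ => congrArg T (funext fun j => ?_)
  by_cases h : j = s
  · subst h
    simp [Equiv.piSplitAt]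
  · simp [Equiv.piSplitAt, h]

theorem sum_matricise_mul (s : Fin d) (T U : Tensor n) :
    ∑ a, ∑ c, matricise s T a c * matricise s U a c = tensorInner T U :=
  sum_matricise s fun i => T i * U i

/-- Slices can be prescribed independently, so maximisers found slice by slice glue to one tensor.
-/
theorem exists_matricise_eq (s : Fin d)
    (y : Fin (n s) → (∀ j : {j : Fin d // j ≠ s}, Fin (n j)) → ℝ)
    (hy : ∀ a c, 0 ≤ y a c) :
    ∃ T : Tensor n, (∀ i, 0 ≤ T i) ∧ ∀ a, matricise s T a = y a := by
  refine ⟨fun i => y (i s) fun j => i j, fun i => hy _ _, fun a => funext fun c => ?_⟩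
  have h : (fun j : {j : Fin d // j ≠ s} => (if h : j.1 = s then
      Fin.cast (congrArg n h.symm) a else c ⟨j, h⟩ : Fin (n j))) = c :=
    funext fun j => dif_neg j.2
  simp only [matricise, dite_true]
  rw [h]
  rfl

/-- The conjugate of an optimal transport loss, and its growth along coordinate directions. -/
theorem IsOTLoss.exists_conj (hΦ : IsOTLoss ε lam Φ X) (hε : 0 < ε) (hlam : 0 < lam)
    (hX : ∀ i, 0 ≤ X i) :
    ∃ (G : Tensor n → ℝ) (M : ℝ), ContDiffOn ℝ ∞ G {U | ∀ i, U i < lam} ∧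
      (∀ U, (∀ i, U i < lam) →
        (∀ Y, (∀ i, 0 ≤ Y i) → ((tensorInner Y U - G U : ℝ) : EReal) ≤ Φ X Y) ∧
        ∃ Y, (∀ i, 0 ≤ Y i) ∧ Φ X Y ≤ ((tensorInner Y U - G U : ℝ) : EReal)) ∧
      ∀ T : Tensor n, (∀ i, 0 ≤ T i) → Φ X (X + T) ≤ ((M + lam * ∑ i, T i : ℝ) : EReal) := by
  rcases hΦ with ⟨c, hc⟩ | ⟨s, c, hc⟩
  · obtain ⟨M, hM⟩ := exists_forall_semiOT_add_le (ε := ε) (c := c) hlam hX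
    refine ⟨semiOTConj ε lam c X, M, contDiffOn_semiOTConj hlam (v := fun U => U)
      (fun j => contDiff_apply ℝ ℝ j) fun U hU => hU, fun U hU => ⟨fun Y hY => ?_, ?_⟩,
      fun T hT => ?_⟩
    · rw [hc Y hY]
      exact le_semiOT hε hlam hY hU
    · obtain ⟨b, hb, hle⟩ := exists_semiOT_le (c := c) hε hlam hX hU
      exact ⟨b, hb, (hc b hb).trans_le hle⟩
    · rw [hc (X + T) fun i => add_nonneg (hX i) (hT i)]
      exact hM T hT
  · have hXm : ∀ a j, 0 ≤ matricise s X a j := fun a j => hX _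
    choose M hM using fun a => exists_forall_semiOT_add_le (ε := ε) (c := c) hlam (hXm a)
    refine ⟨fun U => ∑ a, semiOTConj ε lam c (matricise s X a) (matricise s U a), ∑ a, M a,
      ContDiffOn.sum fun a _ => contDiffOn_semiOTConj hlam (v := fun U => matricise s U a)
        (fun j => contDiff_apply ℝ ℝ _) fun U hU j => hU _,
      fun U hU => ⟨fun Y hY => ?_, ?_⟩, fun T hT => ?_⟩
    · rw [hc Y hY, ← sum_matricise_mul s, ← Finset.sum_sub_distrib, coe_finset_sum_ereal]
      exact Finset.sum_le_sum fun a _ => le_semiOT hε hlam (fun j => hY _) fun j => hU _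
    · choose y hy hle using fun a => exists_semiOT_le (c := c) hε hlam (hXm a)
        (u := matricise s U a) fun j => hU _
      obtain ⟨Y, hY, hYy⟩ := exists_matricise_eq s y hy
      refine ⟨Y, hY, ?_⟩
      rw [hc Y hY, ← sum_matricise_mul s, ← Finset.sum_sub_distrib, coe_finset_sum_ereal]
      refine Finset.sum_le_sum fun a _ => ?_
      rw [hYy a]
      exact hle a
    · rw [hc (X + T) fun i => add_nonneg (hX i) (hT i), ← sum_matricise s, Finset.mul_sum,
        ← Finset.sum_add_distrib, coe_finset_sum_ereal]
      exact Finset.sum_le_sum fun a _ => hM a (matricise s T a) fun j => hT _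

/-- Nothing is claimed where some `U i = λ` and the others are at most `λ`: such points do not
affect the interior of the domain. -/
theorem IsOTLoss.lossConj_eq (hΦ : IsOTLoss ε lam Φ X) (hε : 0 < ε) (hlam : 0 < lam)
    (hX : ∀ i, 0 ≤ X i) :
    (∃ G : Tensor n → ℝ, ContDiffOn ℝ ∞ G {U | ∀ i, U i < lam} ∧
      ∀ U, (∀ i, U i < lam) → lossConj Φ X U = (G U : EReal)) ∧
    ∀ U, lossConj Φ X U ≠ ⊤ → ∀ i, U i ≤ lam := by
  obtain ⟨G, M, hG, hGU, hM⟩ := hΦ.exists_conj hε hlam hX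
  refine ⟨⟨G, hG, fun U hU => le_antisymm (iSup_le fun Y => ?_) ?_⟩, fun U hU i => ?_⟩
  · unfold extLoss
    split_ifs with hY
    · refine (EReal.sub_le_sub le_rfl ((hGU U hU).1 Y hY)).trans_eq ?_
      rw [← EReal.coe_sub, sub_sub_cancel]
    · simp
  · obtain ⟨Y, hY, hle⟩ := (hGU U hU).2
    refine le_trans ?_ (le_legendre (pair := tensorInner) (f := extLoss Φ X) Y U)
    rw [extLoss, if_pos hY]
    refine le_trans ?_ (EReal.sub_le_sub le_rfl hle)
    rw [← EReal.coe_sub, sub_sub_cancel]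
  · by_contra! hlt
    refine hU ((EReal.eq_top_iff_forall_lt _).2 fun y => ?_)
    -- Along `X + t eᵢ` the pairing gains `t U i` while the loss gains at most `λ t`, so a large `t`
    -- passes any level `y`.
    obtain ⟨t, ht0, ht⟩ : ∃ t : ℝ, 0 ≤ t ∧ y < tensorInner X U - M + t * (U i - lam) := by
      have hpos : 0 < U i - lam := sub_pos.2 hlt
      refine ⟨(|y - (tensorInner X U - M)| + 1) / (U i - lam), by positivity, ?_⟩
      rw [div_mul_cancel₀ _ hpos.ne']
      linarith [le_abs_self (y - (tensorInner X U - M))]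
    have hT : ∀ j, 0 ≤ (Pi.single i t : Tensor n) j := by
      intro j
      rcases eq_or_ne j i with rfl | h
      · simpa using ht0
      · simp [Pi.single_eq_of_ne h]
    have hXT : ∀ j, 0 ≤ (X + Pi.single i t : Tensor n) j := fun j => add_nonneg (hX j) (hT j)
    have h1 := le_legendre (pair := tensorInner) (f := extLoss Φ X) (X + Pi.single i t) U
    rw [extLoss, if_pos hXT] at h1
    refine lt_of_lt_of_le ?_ ((EReal.sub_le_sub le_rfl (hM _ hT)).trans h1)
    rw [← EReal.coe_sub, EReal.coe_lt_coe_iff]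
    have h2 : tensorInner (X + Pi.single i t) U = tensorInner X U + t * U i := by
      simp [tensorInner, add_mul, Finset.sum_add_distrib, Pi.single_apply]
    rw [h2, Finset.sum_pi_single']
    simp only [Finset.mem_univ, if_true]
    linarith

end TransportLoss

/-! ### The dual problem for a factor matrix -/

theorem isMaxOn_sub_entropyOn_of_normalised {m n : ℕ} {C : Set (Matrix (Fin m) (Fin n) ℝ)}
    {V N : Matrix (Fin m) (Fin n) ℝ} {ν : ℝ} (hN : ∀ B ∈ C, matInner B N = ν)
    (hZ : (V - N).map Real.exp ∈ C) :
    IsMaxOn (fun B => ((matInner B V : ℝ) : EReal) - entropyOn C B) Set.univ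
      ((V - N).map Real.exp) := fun B _ =>
  (sub_entropyOn_le_of_normalised hN B).trans (sub_entropyOn_eq_of_normalised hN hZ).ge

/-- The explicit maximisers of the recovery problem for the four standard constraints. -/
theorem eq_of_isMaxOn_of_isNormalisation {m n : ℕ} {C : Set (Matrix (Fin m) (Fin n) ℝ)}
    {V B : Matrix (Fin m) (Fin n) ℝ} (hC : Convex ℝ C) (hB : B ∈ C) (h0 : ∀ i j, 0 ≤ B i j)
    (hmax : IsMaxOn (fun B => ((matInner B V : ℝ) : EReal) - entropyOn C B) Set.univ B) :
    (C = Set.univ → B = V.map Real.exp) ∧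
    (C = totalNormalised m n →
      B = (matInner (V.map Real.exp) (Matrix.of fun _ _ => 1))⁻¹ • V.map Real.exp) ∧
    (C = rowNormalised m n → B = (Matrix.diagonal (V.map Real.exp *ᵥ 1))⁻¹ * V.map Real.exp) ∧
    (C = colNormalised m n →
      B = V.map Real.exp * (Matrix.diagonal ((V.map Real.exp)ᵀ *ᵥ 1))⁻¹) := by
  -- A multiplier constant on `C` whose exponential lies in `C` gives a maximiser; uniqueness
  -- identifies it with `B`.
  have key : ∀ (N : Matrix (Fin m) (Fin n) ℝ) (ν : ℝ), (∀ B ∈ C, matInner B N = ν) →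
      (V - N).map Real.exp ∈ C → B = (V - N).map Real.exp := fun N ν hN hZ =>
    eq_of_isMaxOn_sub_entropyOn hC hB h0 hmax (isMaxOn_sub_entropyOn_of_normalised hN hZ)
  refine ⟨?_, ?_, ?_, ?_⟩ <;> rintro rfl
  · have h := key 0 0 (fun B _ => by simp [matInner]) (Set.mem_univ _)
    rwa [sub_zero] at h
  · obtain ⟨-, he, hm⟩ := exp_mem_totalNormalised hB V
    have hz : matInner (V.map Real.exp) (Matrix.of fun _ _ => 1) = ∑ i, ∑ j, Real.exp (V i j) := by
      simp [matInner]
    rw [hz, ← he]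
    refine key _ (Real.log (∑ i, ∑ j, Real.exp (V i j))) (fun B hB => ?_) (he ▸ hm)
    simp only [totalNormalised, matInner, Set.mem_ofPred_eq, Matrix.of_apply, mul_one] at hB
    simp only [matInner, Matrix.of_apply, ← Finset.sum_mul, hB, one_mul]
  · obtain ⟨-, he, hm⟩ := exp_mem_rowNormalised hB V
    rw [← he]
    refine key _ (∑ i, Real.log (∑ j, Real.exp (V i j))) (fun B hB => ?_) (he ▸ hm)
    rw [mem_rowNormalised] at hB
    simp only [matInner, Matrix.of_apply, ← Finset.sum_mul, hB, one_mul]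
  · obtain ⟨-, he, hm⟩ := exp_mem_colNormalised hB V
    rw [← he]
    refine key _ (∑ j, Real.log (∑ i, Real.exp (V i j))) (fun B hB => ?_) (he ▸ hm)
    rw [mem_colNormalised] at hB
    simp only [matInner, Matrix.of_apply]
    rw [Finset.sum_comm]
    simp only [← Finset.sum_mul, hB, one_mul]

theorem extLoss_ne_bot {d : ℕ} {n : Fin d → ℕ} {Φ : Tensor n → Tensor n → EReal} {X : Tensor n}
    (hΦ : ∀ Y : Tensor n, (∀ i, 0 ≤ Y i) → Φ X Y ≠ ⊥) (Y : Tensor n) : extLoss Φ X Y ≠ ⊥ := by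
  unfold extLoss
  split_ifs with h
  · exact hΦ Y h
  · exact bot_ne_top.symm

theorem tensorInner_add_smul_right {d : ℕ} {n : Fin d → ℕ} (T U V : Tensor n) (a b : ℝ) :
    tensorInner T (a • U + b • V) = a * tensorInner T U + b * tensorInner T V := by
  simp only [tensorInner, Pi.add_apply, Pi.smul_apply, smul_eq_mul, Finset.mul_sum,
    ← Finset.sum_add_distrib]
  exact Finset.sum_congr rfl fun i _ => by ring

theorem recoveryObj_eq {d : ℕ} {n r : Fin d → ℕ} (k : Fin d)
    (C : Set (Matrix (Fin (n k)) (Fin (r k)) ℝ)) (ρ : ℝ) (S : Tensor r)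
    (A : ∀ j, Matrix (Fin (n j)) (Fin (r j)) ℝ) (U : Tensor n) :
    recoveryObj k C ρ S A U =
      fun B => ((matInner B ((-1 / ρ) • Xi k S A U) : ℝ) : EReal) - entropyOn C B :=
  funext fun B => by rw [recoveryObj, matInner_smul_right]

theorem interior_setOf_forall_le {ι : Type*} [Finite ι] (c : ℝ) :
    interior {u : ι → ℝ | ∀ i, u i ≤ c} = {u | ∀ i, u i < c} := by
  have h : {u : ι → ℝ | ∀ i, u i ≤ c} = Set.univ.pi fun _ => Set.Iic c := by
    ext u
    simp only [Set.mem_univ_pi, Set.mem_ofPred_eq, Set.mem_Iic]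
  rw [h, interior_pi_set Set.finite_univ]
  ext u
  simp

theorem isOpen_setOf_forall_lt {ι : Type*} [Finite ι] (c : ℝ) :
    IsOpen {u : ι → ℝ | ∀ i, u i < c} := by
  rw [← interior_setOf_forall_le]
  exact isOpen_interior

/-- Smoothness of a sum of a conjugate and a finite smooth function. -/
theorem contDiffOn_toReal_add {E : Type*} [NormedAddCommGroup E] [NormedSpace ℝ E]
    {f : E → EReal} {F : E → ℝ} {ρ : ℝ} {m : ℕ∞} {s : Set E} (hbot : ∀ x, f x ≠ ⊥)
    (hf : ∀ x ∈ s, f x ≠ ⊤) (hfs : ContDiffOn ℝ m (fun x => (f x).toReal) s)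
    (hF : ContDiff ℝ ∞ F) :
    (∀ x ∈ s, f x + (ρ : EReal) * (F x : EReal) ≠ ⊤) ∧
      ContDiffOn ℝ m (fun x => (f x + (ρ : EReal) * (F x : EReal)).toReal) s := by
  constructor
  · intro x hx
    rw [← EReal.coe_mul]
    exact EReal.add_ne_top (hf x hx) (EReal.coe_ne_top _)
  · have hF' : ContDiff ℝ m F := hF.of_le (by exact_mod_cast le_top)
    refine (hfs.add (contDiffOn_const (c := ρ) |>.mul hF'.contDiffOn)).congr fun x hx => ?_
    rw [← EReal.coe_mul, EReal.toReal_add (hf x hx) (hbot x) (EReal.coe_ne_top _)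
      (EReal.coe_ne_bot _), EReal.toReal_coe]

end TuckerDual

end

/-! ### Duality, recovery and smoothness for the factor problem. -/

theorem mainTheorem2 {d : ℕ} (n r : Fin d → ℕ) (k : Fin d)
    -- the loss, with values in `(-∞, ∞]` on non-negative tensors; the data; the fixed factors
    (Φ : Tensor n → Tensor n → EReal) (X : Tensor n) (hX : ∀ i, 0 ≤ X i)
    (S : Tensor r) (hS : ∀ i, 0 ≤ S i)
    (A : ∀ j, Matrix (Fin (n j)) (Fin (r j)) ℝ) (hA : ∀ j, j ≠ k → ∀ a b, 0 ≤ A j a b)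
    (ρ : ℝ) (hρ : 0 < ρ)
    -- the constraint set
    (C : Set (Matrix (Fin (n k)) (Fin (r k)) ℝ)) (hCconv : Convex ℝ C) (hCclosed : IsClosed C)
    -- `Φ(X, ·)` is convex and lower semicontinuous
    (hΦbot : ∀ Y : Tensor n, (∀ i, 0 ≤ Y i) → Φ X Y ≠ ⊥)
    (hΦconv : EConvex (extLoss Φ X)) (hΦlsc : LowerSemicontinuous (extLoss Φ X))
    -- the constraint set contains a positive matrix
    (hfeas : ∃ B ∈ C, ∀ a b, 0 < B a b)
    -- at the tensors built from the positive factors in the constraint set, `Φ(X, ·)` is finite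
    -- and differentiable relative to its domain
    (hΦdiff : ∀ B ∈ C, (∀ a b, 0 < B a b) →
      extLoss Φ X (tucker S (Function.update A k B)) ≠ ⊤ ∧
      DifferentiableWithinAt ℝ (fun Y => (extLoss Φ X Y).toReal) {Y | extLoss Φ X Y ≠ ⊤}
        (tucker S (Function.update A k B))) :
    -- `Ξ⁽ᵏ⁾` is linear
    IsLinearMap ℝ (Xi (n := n) k S A) ∧
    -- the dual problem is convex
    (∀ U, dualObj k Φ C ρ X S A U ≠ ⊥) ∧ EConvex (dualObj k Φ C ρ X S A) ∧
    -- strong duality, with both optimal values finite and attained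
    (∃ B, IsMinOn (primalObj k Φ C ρ X S A) Set.univ B) ∧
    (∃ U, IsMinOn (dualObj k Φ C ρ X S A) Set.univ U) ∧
    (∃ v : ℝ, (⨅ B, primalObj k Φ C ρ X S A B) = (v : EReal) ∧
      (⨅ U, dualObj k Φ C ρ X S A U) = ((-v : ℝ) : EReal)) ∧
    -- recovery of the optimal factor from any dual optimum
    (∀ U, IsMinOn (dualObj k Φ C ρ X S A) Set.univ U →
      ∃ Bopt : Matrix (Fin (n k)) (Fin (r k)) ℝ,
        (∀ B, IsMinOn (primalObj k Φ C ρ X S A) Set.univ B ↔ B = Bopt) ∧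
        (∀ B, IsMaxOn (recoveryObj k C ρ S A U) Set.univ B ↔ B = Bopt) ∧
        (C = Set.univ → Bopt = expFactor k ρ S A U) ∧
        (C = totalNormalised (n k) (r k) →
          Bopt = (matInner (expFactor k ρ S A U) (Matrix.of fun _ _ => 1))⁻¹ •
            expFactor k ρ S A U) ∧
        (C = rowNormalised (n k) (r k) →
          Bopt = (Matrix.diagonal (expFactor k ρ S A U *ᵥ 1))⁻¹ * expFactor k ρ S A U) ∧
        (C = colNormalised (n k) (r k) →
          Bopt = expFactor k ρ S A U * (Matrix.diagonal ((expFactor k ρ S A U)ᵀ *ᵥ 1))⁻¹)) ∧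
    -- smoothness of the dual problem
    (IsNormalisation C →
      -- the entropy term is finite and smooth on the whole space
      (∀ U, entropyConj k C ρ S A U ≠ ⊤ ∧ entropyConj k C ρ S A U ≠ ⊥) ∧
      ContDiff ℝ ∞ (fun U => (entropyConj k C ρ S A U).toReal) ∧
      -- the objective is as smooth as `Φ*` wherever `Φ*` is finite
      (∀ (m : ℕ∞) (V : Set (Tensor n)), IsOpen V → (∀ U ∈ V, lossConj Φ X U ≠ ⊤) →
        ContDiffOn ℝ m (fun U => (lossConj Φ X U).toReal) V →
        (∀ U ∈ V, dualObj k Φ C ρ X S A U ≠ ⊤) ∧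
        ContDiffOn ℝ m (fun U => (dualObj k Φ C ρ X S A U).toReal) V) ∧
      -- for the optimal transport losses it is smooth on the interior of its domain
      (∀ ε lam : ℝ, 0 < ε → 0 < lam → IsOTLoss ε lam Φ X →
        interior {U | dualObj k Φ C ρ X S A U ≠ ⊤} = {U | ∀ i, U i < lam} ∧
        ContDiffOn ℝ ∞ (fun U => (dualObj k Φ C ρ X S A U).toReal) {U | ∀ i, U i < lam})) := by
  have hbot := extLoss_ne_bot (Φ := Φ) (X := X) hΦbot
  have hadj : ∀ B U, tensorInner (tuckerLin k S A B) U = matInner B (Xi k S A U) :=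
    fun B U => tensorInner_tucker_update k S A B U
  obtain ⟨B, hB, h0, q, hq, hmin, U₀, hU₀⟩ := exists_primal_dual (L := tuckerLin k S A) hρ hadj
    hbot hΦconv hΦlsc hCconv hCclosed hfeas hΦdiff
  change dualObj k Φ C ρ X S A U₀ = _ at hU₀
  change IsMinOn (primalObj k Φ C ρ X S A) Set.univ B at hmin
  set v : ℝ := q + ρ * entropyVal B with hv
  have hPB : primalObj k Φ C ρ X S A B = (v : EReal) := by
    refine (add_mul_entropyOn_of_mem (ψ := fun B => extLoss Φ X (tuckerLin k S A B)) hB h0).trans ?_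
    simp only [hq]
    exact (EReal.coe_add _ _).symm
  have hweak : ∀ U, ((-v : ℝ) : EReal) ≤ dualObj k Φ C ρ X S A U := fun U =>
    (neg_le_dual hρ hadj hB h0 hq U).1
  have hloss : ∀ U, lossConj Φ X U ≠ ⊥ := fun U =>
    legendre_ne_bot (z := tuckerLin k S A B) (by rw [hq]; exact EReal.coe_ne_top _) U
  -- Every dual minimiser has value `-v`, so the one primal minimiser `B` solves the recovery
  -- problem of each of them.
  have hrecU : ∀ U, IsMinOn (dualObj k Φ C ρ X S A) Set.univ U →
      IsMaxOn (fun B => ((matInner B ((-1 / ρ) • Xi k S A U) : ℝ) : EReal) - entropyOn C B)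
        Set.univ B := fun U hU =>
    (neg_le_dual hρ hadj hB h0 hq U).2
      (le_antisymm ((hU (Set.mem_univ U₀)).trans_eq hU₀) (hweak U))
  refine ⟨isLinearMap_Xi k S A, fun U h => ?_, ?_, ⟨B, hmin⟩, ⟨U₀, fun U _ => ?_⟩,
    ⟨v, ?_, ?_⟩, fun U hU => ⟨B, ?_, ?_, ?_⟩, fun hnorm => ?_⟩
  · have h1 := hweak U
    rw [h, le_bot_iff] at h1
    exact EReal.coe_ne_bot _ h1
  · have hlin : IsLinearMap ℝ fun U => (-1 / ρ) • Xi k S A U :=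
      (((-1 / ρ) • (isLinearMap_Xi k S A).mk' : Tensor n →ₗ[ℝ] _)).isLinear
    exact (econvex_legendre hbot tensorInner_add_smul_right).add
      (((econvex_legendre entropyOn_ne_bot matInner_add_smul_right).comp_isLinearMap hlin).const_mul
        hρ.le)
  · exact hU₀.trans_le (hweak U)
  · exact le_antisymm ((iInf_le _ B).trans_eq hPB) (le_iInf fun B' => hPB.ge.trans (hmin trivial))
  · exact le_antisymm ((iInf_le _ U₀).trans_eq hU₀) (le_iInf hweak)
  · have hDU : dualObj k Φ C ρ X S A U = ((-v : ℝ) : EReal) :=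
      le_antisymm ((hU (Set.mem_univ U₀)).trans_eq hU₀) (hweak U)
    intro B'
    refine ⟨fun hB' => ?_, fun h => h ▸ hmin⟩
    have hPB' : primalObj k Φ C ρ X S A B' = (v : EReal) :=
      le_antisymm ((hB' (Set.mem_univ B)).trans_eq hPB) (hPB.ge.trans (hmin (Set.mem_univ B')))
    by_cases h : B' ∈ C ∧ ∀ i j, 0 ≤ B' i j
    · have h1 := (add_mul_entropyOn_of_mem (ρ := ρ)
        (ψ := fun B => extLoss Φ X (tuckerLin k S A B)) h.1 h.2).symm.trans hPB'
      have hne : extLoss Φ X (tuckerLin k S A B') ≠ ⊤ := fun htop => by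
        simp only [htop, EReal.top_add_coe] at h1
        exact EReal.coe_ne_top _ h1.symm
      obtain ⟨q', hq'⟩ : ∃ q' : ℝ, extLoss Φ X (tuckerLin k S A B') = q' :=
        ⟨_, (EReal.coe_toReal hne (hbot _)).symm⟩
      simp only [hq'] at h1
      rw [← EReal.coe_add, EReal.coe_eq_coe_iff] at h1
      -- Uniqueness in the primal comes through the dual: `B'` also closes the gap with `U`, so `B`
      -- and `B'` maximise the same strictly concave recovery objective.
      exact eq_of_isMaxOn_sub_entropyOn hCconv hB h0
        ((neg_le_dual hρ hadj h.1 h.2 hq' U).2 (by rw [h1]; exact hDU)) (hrecU U hU)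
    · have h1 := (add_mul_entropyOn_eq_top (ψ := fun B => extLoss Φ X (tuckerLin k S A B)) hρ
        (fun _ => hbot _) h).symm.trans hPB'
      exact absurd h1.symm (EReal.coe_ne_top _)
  · rw [recoveryObj_eq]
    exact fun B' => ⟨fun hB' => eq_of_isMaxOn_sub_entropyOn hCconv hB h0 hB' (hrecU U hU),
      fun h => h ▸ hrecU U hU⟩
  · exact eq_of_isMaxOn_of_isNormalisation hCconv hB h0 (hrecU U hU)
  · obtain ⟨F, hF, hFU⟩ := exists_contDiff_legendre_entropyOn hnorm ⟨B, hB⟩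
      (W := fun U : Tensor n => (-1 / ρ) • Xi k S A U)
      fun i j => contDiff_const.mul (contDiff_Xi_apply k S A i j)
    have hent : ∀ U, entropyConj k C ρ S A U = (F U : EReal) := hFU
    have hdual : dualObj k Φ C ρ X S A = fun U => lossConj Φ X U + (ρ : EReal) * (F U : EReal) :=
      funext fun U => by rw [dualObj, hent]
    have hsmooth : ∀ (m : ℕ∞) (V : Set (Tensor n)), (∀ U ∈ V, lossConj Φ X U ≠ ⊤) →
        ContDiffOn ℝ m (fun U => (lossConj Φ X U).toReal) V →
        (∀ U ∈ V, dualObj k Φ C ρ X S A U ≠ ⊤) ∧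
        ContDiffOn ℝ m (fun U => (dualObj k Φ C ρ X S A U).toReal) V := fun m V hV hVs => by
      rw [hdual]
      exact contDiffOn_toReal_add hloss hV hVs hF
    refine ⟨fun U => by rw [hent]; exact ⟨EReal.coe_ne_top _, EReal.coe_ne_bot _⟩, ?_,
      fun m V _ => hsmooth m V, fun ε lam hε hlam hOT => ?_⟩
    · simpa only [hent, EReal.toReal_coe] using hF
    · obtain ⟨⟨G, hG, hGU⟩, hdom⟩ := hOT.lossConj_eq hε hlam hX
      have h := hsmooth ⊤ {U | ∀ i, U i < lam}
        (fun U hU => by rw [hGU U hU]; exact EReal.coe_ne_top _)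
        (hG.congr fun U hU => by rw [hGU U hU, EReal.toReal_coe])
      -- The domain contains the open set `{U < λ}` and lies in `{U ≤ λ}`, whose interior is that
      -- open set.
      refine ⟨Set.Subset.antisymm ?_ (interior_maximal h.1 (isOpen_setOf_forall_lt lam)), h.2⟩
      rw [← interior_setOf_forall_le]
      refine interior_mono fun U hU => hdom U fun htop => hU ?_
      rw [hdual]
      simp only [htop]
      rw [← EReal.coe_mul, EReal.top_add_coe]
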